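/- Let $N,M\ge 1$. There are $N$ independent linear processes $\mathbf{x}_n(t+1)=\mathbf{A}_n\mathbf{x}_n(t)+\mathbf{w}_n(t)$, $\mathbf{y}_n(t)=\mathbf{C}_n\mathbf{x}_n(t)+\mathbf{v}_n(t)$, $n=1,\dots,N$, where $\mathbf{w}_n(t)$ and $\mathbf{v}_n(t)$ are mutually independent, i.i.d. in time, zero-mean Gaussian with covariances $\mathbf{W}_n$, $\mathbf{V}_n$, and $\rho(\mathbf{A}_1)\ge\dots\ge\rho(\mathbf{A}_N)$ ($\rho$ denotes the spectral radius). Sensor $n$ runs a local Kalman filter with estimate $\mathbf{x}^s_n(t)$, which is in steady state with posterior error covariance $\bar{\mathbf{P}}_n$ and is stable: with $\mathbf{P}^-_n=\mathbf{A}_n\bar{\mathbf{P}}_n\mathbf{A}_n^\top+\mathbf{W}_n$ and $\mathbf{K}_n=\mathbf{P}^-_n\mathbf{C}_n^\top(\mathbf{C}_n\mathbf{P}^-_n\mathbf{C}_n^\top+\mathbf{V}_n)^{-1}$ (the inverse exists) one has $\bar{\mathbf{P}}_n=(\mathbf{I}-\mathbf{K}_n\mathbf{C}_n)\mathbf{P}^-_n$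 and $\rho((\mathbf{I}-\mathbf{K}_n\mathbf{C}_n)\mathbf{A}_n)<1$. The packets $\mathbf{x}^s_n(t)$ are sent to a remote estimator over $M$ frequency channels. The vector channel state $\mathbf{h}(t)$, independent of the processes, is an irreducible aperiodic Markov chain with finitely many states $\mathbf{h}_1,\dots,\mathbf{h}_{\bar M}$ and transition probabilities $p_{i,j}$; given $\mathbf{h}(t)=\mathbf{h}_j$ and the past (all earlier channel states and packet drops), a packet sent in channel $m$ at time $t$ is dropped with probability $d_{j,m}\in[0,1]$. In each slot every packet uses at most one channel and every channel carries at most one packet. If the packet of sensor $n$ is received in slot $t$, then $\hat{\mathbf{x}}_n(t+1)=\mathbf{A}_n\mathbf{x}^s_n(t)$ and the age of information becomes $\phi_n(t+1)=1$; otherwise $\hat{\mathbf{x}}_n(t+1)=\mathbf{A}_n\hat{\mathbf{x}}_n(t)$ and $\phi_n(t+1)=\phi_n(t)+1$. The initial ages $\phi_n(1)\ge 1$ are arbitrary constants; the initial remote error is $\mathcal N\bigl(\mathbf 0,\zeta_n^{\phi_n(1)}(\bar{\mathbf P}_n)\bigr)$ with $\zeta_n(\mathbf X)=\mathbf A_n\mathbf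 X\mathbf A_n^\top+\mathbf W_n$, and the initial data are independent of the subsequent noises, of the channel, and across processes. The channel assignment in slot $t$ is given by a deterministic stationary policy $\pi(\phi_1(t),\dots,\phi_N(t),\mathbf{h}(t-1))$ (only the previous channel state is known). The remote estimator is called stable if some such policy makes $$J=\sum_{n=1}^N\limsup_{T\to\infty}\frac1T\sum_{t=1}^T\mathsf{E}\bigl[\lVert\hat{\mathbf{x}}_n(t)-\mathbf{x}_n(t)\rVert^2\bigr]$$ finite. Theorem. The remote estimator is stable if and only if $\rho_{\max}^2\,\lambda'_\infty<1$, where $\rho_{\max}=\rho(\mathbf{A}_1)$, $$\lambda'_\infty=\liminf_{L\to\infty}\lambda'_L,\qquad \lambda'_L=\min_{\mathbf{v}_1,\dots,\mathbf{v}_L\in\{1,\dots,M\}^{\bar M}}\rho\bigl(\mathbf{E}'(\mathbf{v}_1)\mathbf{E}'(\mathbf{v}_2)\cdots\mathbf{E}'(\mathbf{v}_L)\bigr)^{1/L},$$ and $\mathbf{E}'(\mathbf{v})$ is the $\bar M\times\bar M$ matrix with entries $[\mathbf{E}'(\mathbf{v})]_{i,j}=p_{i,j}\,d_{j,v_i}$.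 -/

import Mathlib

open MeasureTheory ProbabilityTheory Filter
open scoped ENNReal Matrix

noncomputable section

namespace RemoteEst

/-- The spectral radius of a real square matrix: the largest modulus of its complex eigenvalues. -/
def specRad {ι : Type*} [Fintype ι] [DecidableEq ι] (A : Matrix ι ι ℝ) : ℝ :=
  (spectralRadius ℂ (A.map (Complex.ofReal))).toReal

/-! ### Processes and local Kalman filters -/

/-- The parameters of one discrete-time LTI process `x(t+1) = A x(t) + w(t)`, `y(t) = C x(t) + v(t)`
with noise covariances `W` (process noise) and `V` (measurement noise). -/
structure LTI where
  /-- dimension of the process state -/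
  l : ℕ
  /-- dimension of the measurement -/
  r : ℕ
  /-- state transition matrix -/
  A : Matrix (Fin l) (Fin l) ℝ
  /-- measurement matrix -/
  C : Matrix (Fin r) (Fin l) ℝ
  /-- covariance of the process noise -/
  W : Matrix (Fin l) (Fin l) ℝ
  /-- covariance of the measurement noise -/
  V : Matrix (Fin r) (Fin r) ℝ
  W_posSemidef : W.PosSemidef
  V_posSemidef : V.PosSemidef

namespace LTI

variable (s : LTI)

/-- One prediction step for a covariance, `ζ(X) = A X Aᵀ + W`. -/
def zeta (X : Matrix (Fin s.l) (Fin s.l) ℝ) : Matrix (Fin s.l) (Fin s.l) ℝ :=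
  s.A * X * s.Aᵀ + s.W

/-- The innovation covariance `C P⁻ Cᵀ + V`, where `P⁻ = ζ(X)` is the prior covariance obtained
from the posterior covariance `X` of the previous step. -/
def innovCov (X : Matrix (Fin s.l) (Fin s.l) ℝ) : Matrix (Fin s.r) (Fin s.r) ℝ :=
  s.C * s.zeta X * s.Cᵀ + s.V

/-- The Kalman gain `K = P⁻ Cᵀ (C P⁻ Cᵀ + V)⁻¹` computed from the previous posterior covariance. -/
def gain (X : Matrix (Fin s.l) (Fin s.l) ℝ) : Matrix (Fin s.l) (Fin s.r) ℝ :=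
  s.zeta X * s.Cᵀ * (s.innovCov X)⁻¹

/-- One full step `X ↦ (I - K C) P⁻` of the posterior covariance of the Kalman filter. -/
def kalmanStep (X : Matrix (Fin s.l) (Fin s.l) ℝ) : Matrix (Fin s.l) (Fin s.l) ℝ :=
  (1 - s.gain X * s.C) * s.zeta X

/-- `X` is the posterior error covariance of a stable Kalman filter in steady state: it is a
covariance matrix, the gain is well defined, `X` is a fixed point of the covariance recursion,
and the error dynamics `e(t) = (I - K C) A e(t-1) + noise` of the filter are asymptotically
stable. -/
structure IsSteadyState (X : Matrix (Fin s.l) (Fin s.l) ℝ) : Prop where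
  posSemidef : X.PosSemidef
  isUnit_innovCov : IsUnit (s.innovCov X)
  fixed : s.kalmanStep X = X
  stable : specRad ((1 - s.gain X * s.C) * s.A) < 1

end LTI

/-! ### Channels -/

/-- The chain with transition matrix `P` is aperiodic: every state has period one. -/
def IsAperiodic {S : Type*} [Fintype S] [DecidableEq S] (P : Matrix S S ℝ) : Prop :=
  ∀ i : S, ∀ q : ℕ, (∀ k : ℕ, 0 < k → 0 < (P ^ k) i i → q ∣ k) → q = 1

/-- A hidden-state Markov channel with `M` frequency channels: `P` is the transition matrix of an
ergodic (irreducible and aperiodic) chain on the finite set `S` of vector channel states, and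
`d j m` is the probability that a packet sent in frequency channel `m` is dropped when the channel
state is `j`. (For a vector state `j = (j₁, …, j_M)` with `d j m` depending on `j_m` only, `S` is a
product of finite sets.) -/
structure IsHiddenMarkovChannel {S : Type*} [Fintype S] [DecidableEq S] {M : ℕ}
    (P : Matrix S S ℝ) (d : S → Fin M → ℝ) : Prop where
  stochastic : P ∈ Matrix.rowStochastic ℝ S
  irreducible : P.IsIrreducible
  aperiodic : IsAperiodic P
  drop_mem : ∀ j m, d j m ∈ Set.Icc (0 : ℝ) 1

/-! ### The random primitives of the system -/

/-- Labels of the independent sources of randomness. -/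
inductive Source (N : ℕ) where
  /-- the initial data of process `n` -/
  | init (n : Fin N)
  /-- the process noise of process `n` at time `t` -/
  | proc (n : Fin N) (t : ℕ)
  /-- the measurement noise of process `n` at time `t + 1` -/
  | meas (n : Fin N) (t : ℕ)
  /-- the channel (states and packet drops) -/
  | chan

/-- The random primitives on a probability space `(Ω, μ)`. The time slots are numbered by
`t = 0, 1, 2, …`, with `t = 0` the first slot in which the gateway transmits; `h t` is the channel
state just before slot `t` and `h (t + 1)` the channel state during slot `t`; `drop t m` tells
whether a packet sent in frequency channel `m` in slot `t` is dropped. The vector `a` consists of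
the ages of information at the first slot. -/
structure Realization {N M : ℕ} {S : Type*} [Fintype S] [DecidableEq S] (sys : Fin N → LTI)
    (Pbar : (n : Fin N) → Matrix (Fin (sys n).l) (Fin (sys n).l) ℝ)
    (P : Matrix S S ℝ) (d : S → Fin M → ℝ) (a : Fin N → ℕ)
    {Ω : Type*} [MeasurableSpace Ω] (μ : Measure Ω) where
  /-- initial process states -/
  x₀ : (n : Fin N) → Ω → EuclideanSpace ℝ (Fin (sys n).l)
  /-- initial local (sensor) estimates -/
  xs₀ : (n : Fin N) → Ω → EuclideanSpace ℝ (Fin (sys n).l)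
  /-- initial remote estimates -/
  xhat₀ : (n : Fin N) → Ω → EuclideanSpace ℝ (Fin (sys n).l)
  /-- process noise -/
  w : (n : Fin N) → ℕ → Ω → EuclideanSpace ℝ (Fin (sys n).l)
  /-- measurement noise -/
  v : (n : Fin N) → ℕ → Ω → EuclideanSpace ℝ (Fin (sys n).r)
  /-- channel states -/
  h : ℕ → Ω → S
  /-- packet drops -/
  drop : ℕ → Ω → Fin M → Bool
  measurable_x₀ : ∀ n, Measurable (x₀ n)
  measurable_xs₀ : ∀ n, Measurable (xs₀ n)
  measurable_xhat₀ : ∀ n, Measurable (xhat₀ n)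
  measurable_w : ∀ n t, Measurable (w n t)
  measurable_v : ∀ n t, Measurable (v n t)
  measurable_h : ∀ t j, MeasurableSet {ω | h t ω = j}
  measurable_drop : ∀ t, Measurable (drop t)
  /-- The noises are zero-mean Gaussian with covariances `W` and `V`. -/
  law_w : ∀ n t, HasLaw (w n t) (multivariateGaussian 0 (sys n).W) μ
  law_v : ∀ n t, HasLaw (v n t) (multivariateGaussian 0 (sys n).V) μ
  /-- The local filters start in steady state. -/
  law_xs₀ : ∀ n, HasLaw (fun ω => xs₀ n ω - x₀ n ω) (multivariateGaussian 0 (Pbar n)) μ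
  /-- The initial remote estimate of process `n` is a prediction over `a n` steps. -/
  law_xhat₀ : ∀ n, HasLaw (fun ω => xhat₀ n ω - x₀ n ω)
    (multivariateGaussian 0 ((sys n).zeta^[a n] (Pbar n))) μ
  /-- The initial data, the noises at different times and of different processes, and the channel
  are mutually independent. -/
  indep : iIndep (fun s : Source N => match s with
    | .init n => MeasurableSpace.comap (x₀ n) inferInstance ⊔
        MeasurableSpace.comap (xs₀ n) inferInstance ⊔ MeasurableSpace.comap (xhat₀ n) inferInstance
    | .proc n t => MeasurableSpace.comap (w n t) inferInstance
    | .meas n t => MeasurableSpace.comap (v n (t + 1)) inferInstance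
    | .chan => (⨆ t, MeasurableSpace.comap (h t) ⊤) ⊔
        ⨆ t, MeasurableSpace.comap (drop t) inferInstance) μ
  /-- Given the channel states up to the one before slot `t` and all packet drops before slot `t`,
  the next channel state is drawn from the row of `P` that belongs to the previous state. -/
  law_h : ∀ (t : ℕ) (B : Set Ω),
    MeasurableSet[(⨆ k ∈ Set.Iic t, MeasurableSpace.comap (h k) ⊤) ⊔
      ⨆ k ∈ Set.Iio t, MeasurableSpace.comap (drop k) inferInstance] B → ∀ i j,
    μ (B ∩ {ω | h t ω = i ∧ h (t + 1) ω = j}) =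
      μ (B ∩ {ω | h t ω = i}) * ENNReal.ofReal (P i j)
  /-- Given the same history and the new channel state `j`, a packet sent in frequency channel `m`
  is dropped with probability `d j m`. -/
  law_drop : ∀ (t : ℕ) (B : Set Ω),
    MeasurableSet[(⨆ k ∈ Set.Iic t, MeasurableSpace.comap (h k) ⊤) ⊔
      ⨆ k ∈ Set.Iio t, MeasurableSpace.comap (drop k) inferInstance] B → ∀ i j m,
    μ (B ∩ {ω | h t ω = i ∧ h (t + 1) ω = j ∧ drop t ω m = true}) =
      μ (B ∩ {ω | h t ω = i ∧ h (t + 1) ω = j}) * ENNReal.ofReal (d j m)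

/-! ### Scheduling policies -/

/-- A deterministic stationary scheduling policy: from the current ages of information of all
processes and the previous channel state it selects, for each sensor, a frequency channel (`some m`)
or no transmission (`none`). Each packet uses at most one frequency channel, and each frequency
channel carries at most one packet. -/
structure Policy (N M : ℕ) (S : Type*) where
  /-- the selection -/
  select : (Fin N → ℕ) → S → Fin N → Option (Fin M)
  injective : ∀ φ j n n' m, select φ j n = some m → select φ j n' = some m → n = n'

namespace Realization

variable {N M : ℕ} {S : Type*} [Fintype S] [DecidableEq S] {sys : Fin N → LTI}
  {Pbar : (n : Fin N) → Matrix (Fin (sys n).l) (Fin (sys n).l) ℝ}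
  {P : Matrix S S ℝ} {d : S → Fin M → ℝ} {a : Fin N → ℕ}
  {Ω : Type*} [MeasurableSpace Ω] {μ : Measure Ω}
  (R : Realization sys Pbar P d a μ)

/-- The process states, `x(t+1) = A x(t) + w(t)`. -/
def x (n : Fin N) : ℕ → Ω → EuclideanSpace ℝ (Fin (sys n).l)
  | 0, ω => R.x₀ n ω
  | t + 1, ω => (sys n).A.toEuclideanLin (x n t ω) + R.w n t ω

/-- The measurements, `y(t) = C x(t) + v(t)`. -/
def y (n : Fin N) (t : ℕ) (ω : Ω) : EuclideanSpace ℝ (Fin (sys n).r) :=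
  (sys n).C.toEuclideanLin (R.x n t ω) + R.v n t ω

/-- The local Kalman filter estimates (in steady state). -/
def xs (n : Fin N) : ℕ → Ω → EuclideanSpace ℝ (Fin (sys n).l)
  | 0, ω => R.xs₀ n ω
  | t + 1, ω => (sys n).A.toEuclideanLin (xs n t ω) +
      ((sys n).gain (Pbar n)).toEuclideanLin (R.y n (t + 1) ω -
        (sys n).C.toEuclideanLin ((sys n).A.toEuclideanLin (xs n t ω)))

open Classical in
/-- The ages of information `φ(t)` under the policy `π`: the age of process `n` is reset to one if
in slot `t` the packet of sensor `n` is scheduled in a frequency channel and is not dropped, and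
grows by one otherwise. -/
def age (π : Policy N M S) : ℕ → Ω → Fin N → ℕ
  | 0, _, n => a n
  | t + 1, ω, n =>
      if ∃ m, π.select (age π t ω) (R.h t ω) n = some m ∧ R.drop t ω m = false then 1
      else age π t ω n + 1

/-- The packet of sensor `n` is scheduled and successfully received in slot `t`. -/
def Received (π : Policy N M S) (n : Fin N) (t : ℕ) (ω : Ω) : Prop :=
  ∃ m, π.select (R.age π t ω) (R.h t ω) n = some m ∧ R.drop t ω m = false

open Classical in
/-- The remote estimates under the policy `π`: a one-step prediction from the local estimate if the
packet was received, and from the previous remote estimate otherwise. -/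
def xhat (π : Policy N M S) (n : Fin N) : ℕ → Ω → EuclideanSpace ℝ (Fin (sys n).l)
  | 0, ω => R.xhat₀ n ω
  | t + 1, ω => (sys n).A.toEuclideanLin
      (if R.Received π n t ω then R.xs n t ω else xhat π n t ω)

/-- The expected trace of the remote estimation error covariance of process `n` at slot `t`, i.e.
the mean of the squared Euclidean norm of the estimation error. -/
def mse (π : Policy N M S) (n : Fin N) (t : ℕ) : ℝ≥0∞ :=
  ∫⁻ ω, ENNReal.ofReal (‖R.xhat π n t ω - R.x n t ω‖ ^ 2) ∂μ

/-- The sum over all processes of the long-term average mean-square estimation errors. -/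
def cost (π : Policy N M S) : ℝ≥0∞ :=
  ∑ n, limsup (fun T : ℕ => (∑ t ∈ Finset.range T, R.mse π n t) / (T : ℝ≥0∞)) atTop

/-- Average mean-square stability: some deterministic stationary policy has a finite cost. -/
def IsStable : Prop := ∃ π : Policy N M S, R.cost π < ∞

end Realization

/-! ### The quantity `λ'_∞` -/

section Lambda

variable {S : Type*} [Fintype S] [DecidableEq S] {M : ℕ}

/-- The matrix `E'(v)` with entries `p_{ij} d_{j, v_i}`. -/
def failMatrix (P : Matrix S S ℝ) (d : S → Fin M → ℝ) (v : S → Fin M) : Matrix S S ℝ :=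
  Matrix.of fun i j => P i j * d j (v i)

/-- `λ'_L`, the minimum over `v₁, …, v_L` of `ρ(E'(v₁) ⋯ E'(v_L)) ^ (1 / L)`. -/
def lam (P : Matrix S S ℝ) (d : S → Fin M → ℝ) (L : ℕ) : ℝ :=
  ⨅ v : Fin L → S → Fin M,
    specRad (List.ofFn fun k => failMatrix P d (v k)).prod ^ (1 / (L : ℝ))

/-- `λ'_∞ = liminf_{L → ∞} λ'_L`. -/
def lamInf (P : Matrix S S ℝ) (d : S → Fin M → ℝ) : ℝ :=
  liminf (fun L : ℕ => lam P d L) atTop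

end Lambda

end RemoteEst

end

open MeasureTheory ProbabilityTheory Filter
open scoped ENNReal Matrix

noncomputable section

namespace RemoteEst

/-! ### Spectral radii of real matrices -/

section SpectralRadius

open scoped Matrix.Norms.Operator Topology

variable {ι : Type*} [Fintype ι] [DecidableEq ι]

/-! Given the age of information, the remote error is built from process and measurement noises and
initial data alone, which are independent of the channel. An error of age `k` has covariance
`ζ^k(P̄)`, so the mean-square error is the mean of `tr ζ^φ(P̄)` (`mse_eq`), and stability becomes a
question about exponential moments of the ages. The trace is at most `c θ^k` for every `θ > max(1,
ρ²)`. If `ρ ≥ 1` it is at least `ε ∑_{i<k} ρ^{2i}`, because stability of the local filter forces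
each leading mode to be seen by the measurements (`exists_mul_geom_sum_le_trace`).

Row `i` of `E'(v)` depends on `v i` only, so minimising over `v` is done row by row, by the monotone
homogeneous map `T x = (min_m ∑_j p_ij d_jm x_j)_i`. Its cone eigenvalue `r` has a nonzero `x ≥ 0`
with `r x ≤ E'(v) x` for all `v`, and for each `s > r` a positive `y` and a single `v` with `E'(v) y
≤ s y`. Hence `λ'_L = r` for every `L ≥ 1`, and `λ'_∞ = r` (`lamInf_spec`).

Sufficiency: choose `s > r` and `θ > ρ²` with `θ s < 1`, and send the oldest packet in channel
`v(h)`. The function `(∑_n θ^{φ_n} L^{rank n}) y(h)` is a Lyapunov function: a drop multiplies its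
mean by at most `θ s`, while a reception moves every other process up one rank and gains a factor
`L`, which is taken large (`exists_bound_lintegral_pow_age`).

Necessity: let `q = ρ²` with `q r ≥ 1`. Under any policy the mean of `(∑_{k<φ} q^k) x(h)` increases
in each slot by at least the mean of `x(h)` at the next state, and irreducibility makes these
increments add up to infinity (`tendsto_lintegral_geom_sum_age`). The geometric sum, rather than the
power `q^φ`, also settles the critical case `q r = 1`. If `ρ < 1`, every policy is stable and `r ≤
1`, so both sides hold. -/

lemma specRad_nonneg (A : Matrix ι ι ℝ) : 0 ≤ specRad A := ENNReal.toReal_nonneg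

lemma linfty_norm_map_ofReal (A : Matrix ι ι ℝ) : ‖A.map Complex.ofReal‖ = ‖A‖ := by
  rw [Matrix.linfty_opNorm_def, Matrix.linfty_opNorm_def]
  simp

lemma map_ofReal_pow (A : Matrix ι ι ℝ) (n : ℕ) :
    (A ^ n).map Complex.ofReal = (A.map Complex.ofReal) ^ n :=
  map_pow (RingHom.mapMatrix Complex.ofRealHom) A n

lemma spectralRadius_map_ofReal_ne_top (A : Matrix ι ι ℝ) :
    spectralRadius ℂ (A.map Complex.ofReal) ≠ ∞ := by
  refine ne_top_of_le_ne_top ?_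
    (spectrum.spectralRadius_le_pow_nnnorm_pow_one_div ℂ (A.map Complex.ofReal) 0)
  simp [ENNReal.mul_eq_top]

/-- **Gelfand's formula** for a real matrix. -/
lemma tendsto_norm_pow_specRad (A : Matrix ι ι ℝ) :
    Tendsto (fun n : ℕ => ‖A ^ n‖ ^ (1 / n : ℝ)) atTop (𝓝 (specRad A)) := by
  have h := spectrum.pow_norm_pow_one_div_tendsto_nhds_spectralRadius (A.map Complex.ofReal)
  have h2 := (ENNReal.tendsto_toReal (spectralRadius_map_ofReal_ne_top A)).comp h
  refine h2.congr fun n => ?_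
  simp only [Function.comp]
  rw [ENNReal.toReal_ofReal (by positivity), ← map_ofReal_pow, linfty_norm_map_ofReal]

/-- Gelfand's formula gives the bound from some index on; the constant absorbs the finitely many
earlier powers. -/
lemma exists_norm_pow_le_of_specRad_lt (A : Matrix ι ι ℝ) {q : ℝ} (hq : specRad A < q) :
    ∃ C : ℝ, 0 < C ∧ ∀ n : ℕ, ‖A ^ n‖ ≤ C * q ^ n := by
  have hq0 : 0 < q := (specRad_nonneg A).trans_lt hq
  obtain ⟨n₀, hn₀⟩ := eventually_atTop.1
    (((tendsto_norm_pow_specRad A).eventually_lt_const hq).and (eventually_gt_atTop 0))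
  refine ⟨1 + ∑ k ∈ Finset.range n₀, ‖A ^ k‖ / q ^ k, by positivity, fun n => ?_⟩
  rcases lt_or_ge n n₀ with h | h
  · have : ‖A ^ n‖ / q ^ n ≤ ∑ k ∈ Finset.range n₀, ‖A ^ k‖ / q ^ k :=
      Finset.single_le_sum (f := fun k => ‖A ^ k‖ / q ^ k) (fun _ _ => by positivity)
        (Finset.mem_range.2 h)
    rw [← div_le_iff₀ (by positivity)]
    linarith
  · obtain ⟨h1, h2⟩ := hn₀ n h
    have h3 : ‖A ^ n‖ ≤ q ^ n := by
      have := pow_le_pow_left₀ (by positivity) h1.le n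
      rwa [← Real.rpow_natCast, ← Real.rpow_mul (norm_nonneg _), one_div_mul_cancel
        (by positivity), Real.rpow_one] at this
    have h4 : 0 ≤ ∑ k ∈ Finset.range n₀, ‖A ^ k‖ / q ^ k := by positivity
    nlinarith [pow_pos hq0 n]

lemma tendsto_const_mul_pow_root {c s : ℝ} (hc : 0 < c) (hs : 0 ≤ s) :
    Tendsto (fun n : ℕ => (c * s ^ n) ^ (1 / n : ℝ)) atTop (𝓝 s) := by
  have h : Tendsto (fun n : ℕ => c ^ (1 / n : ℝ) * s) atTop (𝓝 (c ^ (0 : ℝ) * s)) :=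
    ((tendsto_const_nhds.rpow tendsto_one_div_atTop_nhds_zero_nat (Or.inl hc.ne'))).mul_const s
  rw [Real.rpow_zero, one_mul] at h
  refine h.congr' ?_
  filter_upwards [eventually_gt_atTop 0] with n hn
  rw [Real.mul_rpow hc.le (by positivity), ← Real.rpow_natCast s n, ← Real.rpow_mul hs,
    mul_one_div_cancel (by positivity), Real.rpow_one]

/-- A positive constant factor disappears under the `n`-th root in Gelfand's formula. -/
lemma le_specRad_of_le_norm_pow (A : Matrix ι ι ℝ) {c s : ℝ} (hc : 0 < c) (hs : 0 ≤ s)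
    (h : ∀ n, c * s ^ n ≤ ‖A ^ n‖) : s ≤ specRad A :=
  le_of_tendsto_of_tendsto' (tendsto_const_mul_pow_root hc hs) (tendsto_norm_pow_specRad A)
    fun n => Real.rpow_le_rpow (by positivity) (h n) (by positivity)

lemma specRad_le_of_norm_pow_le (A : Matrix ι ι ℝ) {c s : ℝ} (hc : 0 < c) (hs : 0 ≤ s)
    (h : ∀ n, ‖A ^ n‖ ≤ c * s ^ n) : specRad A ≤ s :=
  le_of_tendsto_of_tendsto' (tendsto_norm_pow_specRad A) (tendsto_const_mul_pow_root hc hs)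
    fun n => Real.rpow_le_rpow (by positivity) (h n) (by positivity)

lemma linfty_norm_le {A : Matrix ι ι ℝ} {C : ℝ} (hC : 0 ≤ C) (h : ∀ i, ∑ j, |A i j| ≤ C) :
    ‖A‖ ≤ C := by
  lift C to NNReal using hC
  rw [Matrix.linfty_opNorm_def]
  norm_cast
  refine Finset.sup_le fun i _ => ?_
  rw [← NNReal.coe_le_coe]
  simpa using h i

lemma sum_abs_le_linfty_norm (A : Matrix ι ι ℝ) (i : ι) : ∑ j, |A i j| ≤ ‖A‖ := by
  rw [Matrix.linfty_opNorm_def]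
  have : ∑ j, ‖A i j‖₊ ≤ Finset.univ.sup fun i => ∑ j, ‖A i j‖₊ :=
    Finset.le_sup (f := fun i => ∑ j, ‖A i j‖₊) (Finset.mem_univ i)
  have h2 := NNReal.coe_le_coe.2 this
  simpa using h2

lemma abs_apply_le_linfty_norm (A : Matrix ι ι ℝ) (i j : ι) : |A i j| ≤ ‖A‖ :=
  (Finset.single_le_sum (f := fun j => |A i j|) (fun _ _ => abs_nonneg _)
    (Finset.mem_univ j)).trans (sum_abs_le_linfty_norm A i)

/-! ### Entrywise nonnegative matrices -/

lemma mulVec_mono {ι : Type*} [Fintype ι] {B : Matrix ι ι ℝ} (hB : ∀ i j, 0 ≤ B i j) {x y : ι → ℝ} (h : x ≤ y) :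
    B *ᵥ x ≤ B *ᵥ y := fun i =>
  Finset.sum_le_sum fun j _ => mul_le_mul_of_nonneg_left (h j) (hB i j)

lemma pow_apply_nonneg {B : Matrix ι ι ℝ} (hB : ∀ i j, 0 ≤ B i j) (n : ℕ) (i j : ι) :
    0 ≤ (B ^ n) i j := by
  induction n generalizing i j with
  | zero => rw [pow_zero, Matrix.one_apply]; split_ifs <;> simp
  | succ n ih => exact Finset.sum_nonneg fun k _ => mul_nonneg (ih _ _) (hB _ _)

lemma smul_pow_le_pow_mulVec {B : Matrix ι ι ℝ} (hB : ∀ i j, 0 ≤ B i j) {x : ι → ℝ} {c : ℝ}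
    (hc : 0 ≤ c) (h : c • x ≤ B *ᵥ x) (n : ℕ) : c ^ n • x ≤ (B ^ n) *ᵥ x := by
  induction n with
  | zero => simp
  | succ n ih =>
    calc c ^ (n + 1) • x = c ^ n • (c • x) := by rw [smul_smul, pow_succ]
      _ ≤ c ^ n • (B *ᵥ x) := smul_le_smul_of_nonneg_left h (by positivity)
      _ = B *ᵥ (c ^ n • x) := by rw [Matrix.mulVec_smul]
      _ ≤ B *ᵥ ((B ^ n) *ᵥ x) := mulVec_mono hB ih
      _ = (B ^ (n + 1)) *ᵥ x := by rw [Matrix.mulVec_mulVec, pow_succ']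

lemma pow_mulVec_le_smul_pow {B : Matrix ι ι ℝ} (hB : ∀ i j, 0 ≤ B i j) {x : ι → ℝ} {c : ℝ}
    (hc : 0 ≤ c) (h : B *ᵥ x ≤ c • x) (n : ℕ) : (B ^ n) *ᵥ x ≤ c ^ n • x := by
  induction n with
  | zero => simp
  | succ n ih =>
    calc (B ^ (n + 1)) *ᵥ x = B *ᵥ ((B ^ n) *ᵥ x) := by rw [Matrix.mulVec_mulVec, pow_succ']
      _ ≤ B *ᵥ (c ^ n • x) := mulVec_mono hB ih
      _ = c ^ n • (B *ᵥ x) := by rw [Matrix.mulVec_smul]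
      _ ≤ c ^ n • (c • x) := smul_le_smul_of_nonneg_left h (by positivity)
      _ = c ^ (n + 1) • x := by rw [smul_smul, pow_succ]

/-- Lower Collatz–Wielandt bound: iteration gives `c^n x ≤ B^n x`, so a positive coordinate of `x`
forces the norm of `B^n` to grow like `c^n`. -/
lemma le_specRad_of_smul_le_mulVec {B : Matrix ι ι ℝ} (hB : ∀ i j, 0 ≤ B i j) {x : ι → ℝ} {c : ℝ}
    (hx : 0 ≤ x) (hx0 : x ≠ 0) (hc : 0 ≤ c) (h : c • x ≤ B *ᵥ x) : c ≤ specRad B := by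
  obtain ⟨i, hi⟩ : ∃ i, x i ≠ 0 := Function.ne_iff.1 hx0
  have hi0 : 0 < x i := lt_of_le_of_ne (hx i) (Ne.symm hi)
  have hn : 0 < ‖x‖ := norm_pos_iff.2 hx0
  refine le_specRad_of_le_norm_pow B (c := x i / ‖x‖) (by positivity) hc fun n => ?_
  have h1 := smul_pow_le_pow_mulVec hB hc h n i
  have h2 : ((B ^ n) *ᵥ x) i ≤ ‖B ^ n‖ * ‖x‖ :=
    (Real.le_norm_self _).trans ((norm_le_pi_norm _ i).trans (Matrix.linfty_opNorm_mulVec _ _))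
  rw [div_mul_eq_mul_div, div_le_iff₀ hn]
  simp only [Pi.smul_apply, smul_eq_mul] at h1
  linarith

/-- Upper Collatz–Wielandt bound. Positivity of every `y i` is needed: row sums of `B^n` are
compared with `B^n y` through the least coordinate of `y`. -/
lemma specRad_le_of_mulVec_le_smul [Nonempty ι] {B : Matrix ι ι ℝ} (hB : ∀ i j, 0 ≤ B i j)
    {y : ι → ℝ} {s : ℝ} (hy : ∀ i, 0 < y i) (hs : 0 ≤ s) (h : B *ᵥ y ≤ s • y) :
    specRad B ≤ s := by
  obtain ⟨i₀, -, hi₀⟩ := Finset.exists_min_image Finset.univ y Finset.univ_nonempty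
  obtain ⟨i₁, -, hi₁⟩ := Finset.exists_max_image Finset.univ y Finset.univ_nonempty
  refine specRad_le_of_norm_pow_le B (c := y i₁ / y i₀) (div_pos (hy _) (hy _)) hs fun n => ?_
  refine linfty_norm_le (mul_nonneg (div_pos (hy _) (hy _)).le (by positivity)) fun i => ?_
  have h1 := pow_mulVec_le_smul_pow hB hs h n i
  simp only [Pi.smul_apply, smul_eq_mul] at h1
  rw [div_mul_eq_mul_div, le_div_iff₀ (hy _), Finset.sum_mul]
  calc ∑ j, |(B ^ n) i j| * y i₀ ≤ ∑ j, (B ^ n) i j * y j := by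
        refine Finset.sum_le_sum fun j _ => ?_
        rw [abs_of_nonneg (pow_apply_nonneg hB n i j)]
        exact mul_le_mul_of_nonneg_left (hi₀ j (Finset.mem_univ _)) (pow_apply_nonneg hB n i j)
    _ ≤ s ^ n * y i := h1
    _ ≤ y i₁ * s ^ n := by
        rw [mul_comm]
        exact mul_le_mul_of_nonneg_right (hi₁ i (Finset.mem_univ _)) (by positivity)

/-- A sub-eigenvector shared by all factors survives in their product, in whatever order the factors
come. This bounds `λ'_L` below over all channel sequences at once. -/
lemma list_prod_nonneg_and_smul_le {x : ι → ℝ} {c : ℝ} (hc : 0 ≤ c) (l : List (Matrix ι ι ℝ))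
    (hl : ∀ B ∈ l, (∀ i j, 0 ≤ B i j) ∧ c • x ≤ B *ᵥ x) :
    (∀ i j, 0 ≤ l.prod i j) ∧ c ^ l.length • x ≤ l.prod *ᵥ x := by
  induction l with
  | nil =>
    refine ⟨fun i j => ?_, by simp⟩
    rw [List.prod_nil, Matrix.one_apply]; split_ifs <;> simp
  | cons B l ih =>
    obtain ⟨h1, h2⟩ := ih fun B hB => hl B (List.mem_cons_of_mem _ hB)
    obtain ⟨h3, h4⟩ := hl B List.mem_cons_self
    rw [List.prod_cons]
    refine ⟨fun i j => Finset.sum_nonneg fun k _ => mul_nonneg (h3 _ _) (h1 _ _), ?_⟩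
    calc c ^ (l.length + 1) • x = c ^ l.length • (c • x) := by rw [smul_smul, pow_succ]
      _ ≤ c ^ l.length • (B *ᵥ x) := smul_le_smul_of_nonneg_left h4 (by positivity)
      _ = B *ᵥ (c ^ l.length • x) := by rw [Matrix.mulVec_smul]
      _ ≤ B *ᵥ (l.prod *ᵥ x) := mulVec_mono h3 h2
      _ = (B * l.prod) *ᵥ x := by rw [Matrix.mulVec_mulVec]

end SpectralRadius

/-! ### A nonlinear Perron–Frobenius theorem -/

section Perron

open scoped Topology

/-- A monotone, positively homogeneous and continuous self-map of the nonnegative orthant, perturbed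
by a positive constant, has a positive eigenvector in the simplex. -/
lemma exists_pos_eigenvector_add_const {ι : Type*} [Fintype ι] [Nonempty ι]
    {T : (ι → ℝ) → ι → ℝ} (hcont : Continuous T)
    (hmono : ∀ x y, 0 ≤ x → x ≤ y → T x ≤ T y)
    (hhom : ∀ (c : ℝ) (x : ι → ℝ), 0 ≤ c → 0 ≤ x → T (c • x) = c • T x) {ε : ℝ} (hε : 0 < ε) :
    ∃ (r : ℝ) (x : ι → ℝ), 0 ≤ r ∧ (∀ i, 0 < x i) ∧ x ∈ stdSimplex ℝ ι ∧
      ∀ i, T x i + ε = r * x i := by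
  have hT0 : ∀ x, 0 ≤ x → 0 ≤ T x := fun x hx => by
    have h0 : T 0 = 0 := by simpa using hhom 0 0 le_rfl le_rfl
    simpa [h0] using hmono 0 x le_rfl hx
  set x₁ : ι → ℝ := fun _ => (Fintype.card ι : ℝ)⁻¹ with hx₁
  have hcard : (0 : ℝ) < Fintype.card ι := by exact_mod_cast Fintype.card_pos
  have hx₁0 : 0 ≤ x₁ := fun i => by simp [hx₁]
  set b : ℝ := ∑ i, (Fintype.card ι : ℝ) * (T x₁ i + ε) with hb
  have hterm : ∀ i, 0 ≤ (Fintype.card ι : ℝ) * (T x₁ i + ε) := fun i =>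
    mul_nonneg hcard.le (add_nonneg (hT0 _ hx₁0 i) hε.le)
  -- The eigenvalue is found as the least `r` with `T x + ε ≤ r x` for some `x` in the simplex; `b`
  -- is chosen so that the uniform vector is feasible.
  set K : Set ((ι → ℝ) × ℝ) := (stdSimplex ℝ ι ×ˢ Set.Icc 0 b) ∩
    {p | ∀ i, T p.1 i + ε ≤ p.2 * p.1 i} with hK
  have hclosed : IsClosed {p : (ι → ℝ) × ℝ | ∀ i, T p.1 i + ε ≤ p.2 * p.1 i} := by
    rw [Set.ofPred_forall]
    refine isClosed_iInter fun i => isClosed_le ?_ ?_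
    · exact ((continuous_apply i).comp (hcont.comp continuous_fst)).add continuous_const
    · exact continuous_snd.mul ((continuous_apply i).comp continuous_fst)
  have hcomp : IsCompact K :=
    ((isCompact_stdSimplex ℝ ι).prod isCompact_Icc).inter_right hclosed
  have hne : K.Nonempty := by
    refine ⟨(x₁, b), ⟨⟨⟨hx₁0, by simp [hx₁, hcard.ne']⟩, Finset.sum_nonneg fun i _ => hterm i,
      le_rfl⟩, fun i => ?_⟩⟩
    have h1 : (Fintype.card ι : ℝ) * (T x₁ i + ε) ≤ b :=
      Finset.single_le_sum (fun i _ => hterm i) (Finset.mem_univ i)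
    change T x₁ i + ε ≤ b * (Fintype.card ι : ℝ)⁻¹
    rw [← div_eq_mul_inv, le_div_iff₀ hcard]
    linarith
  obtain ⟨⟨x, r⟩, ⟨⟨hxs, hr⟩, hxr⟩, hmin⟩ := hcomp.exists_isMinOn hne continuous_snd.continuousOn
  simp only [Set.mem_ofPred_eq, Set.mem_Icc] at hxr hr hxs
  have hxnn : 0 ≤ x := hxs.1
  have hrx : ∀ i, 0 < r * x i := fun i =>
    (add_pos_of_nonneg_of_pos (hT0 x hxnn i) hε).trans_le (hxr i)
  have hrpos : 0 < r := by
    obtain ⟨i⟩ := ‹Nonempty ι›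
    exact pos_of_mul_pos_left (hrx i) (hxnn i)
  have hxpos : ∀ i, 0 < x i := fun i => pos_of_mul_pos_right (hrx i) hrpos.le
  refine ⟨r, x, hr.1, hxpos, hxs, ?_⟩
  by_contra hcon
  push Not at hcon
  obtain ⟨i₀, hi₀⟩ := hcon
  have hlt : T x i₀ + ε < r * x i₀ := lt_of_le_of_ne (hxr i₀) hi₀
  -- If the inequality is strict somewhere, then `y = T x + ε` has coordinate sum `σ < r`. Its
  -- normalisation `z = y/σ` satisfies the constraint with slack `ε(r - σ)/σ` in every coordinate,
  -- so `r` was not minimal.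
  set y : ι → ℝ := fun i => T x i + ε with hy
  have hypos : ∀ i, 0 < y i := fun i => add_pos_of_nonneg_of_pos (hT0 x hxnn i) hε
  set σ : ℝ := ∑ i, y i with hσ
  have hσpos : 0 < σ := Finset.sum_pos (fun i _ => hypos i) Finset.univ_nonempty
  have hσr : σ < r := by
    calc σ < ∑ i, r * x i :=
          Finset.sum_lt_sum (fun i _ => hxr i) ⟨i₀, Finset.mem_univ _, hlt⟩
      _ = r := by rw [← Finset.mul_sum, hxs.2, mul_one]
  have hTy : ∀ i, T y i ≤ r * (y i - ε) := fun i => by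
    have h1 := hmono y (r • x) (fun i => (hypos i).le) (fun i => hxr i) i
    rw [hhom r x hr.1 hxnn] at h1
    simpa [hy] using h1
  set z : ι → ℝ := σ⁻¹ • y with hz
  have hzs : z ∈ stdSimplex ℝ ι := by
    refine ⟨fun i => mul_nonneg (inv_nonneg.2 hσpos.le) (hypos i).le, ?_⟩
    simp only [hz, Pi.smul_apply, smul_eq_mul]
    rw [← Finset.mul_sum, inv_mul_cancel₀ hσpos.ne']
  have hTz : ∀ i, T z i + ε ≤ r * z i - ε * (r - σ) / σ := fun i => by
    rw [hz, hhom _ _ (inv_nonneg.2 hσpos.le) fun i => (hypos i).le]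
    simp only [Pi.smul_apply, smul_eq_mul]
    have h1 := mul_le_mul_of_nonneg_left (hTy i) (inv_nonneg.2 hσpos.le)
    have h2 : σ⁻¹ * (r * (y i - ε)) + ε = r * (σ⁻¹ * y i) - ε * (r - σ) / σ := by
      field_simp
      ring
    linarith
  -- The minimum with `r` keeps `r - δ ≥ 0`; since `z i ≤ 1`, lowering `r` by `δ` costs at most `δ`
  -- in each coordinate.
  set δ : ℝ := min (ε * (r - σ) / σ) r with hδ
  have hδpos : 0 < δ := lt_min (div_pos (mul_pos hε (sub_pos.2 hσr)) hσpos) hrpos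
  have hmem : (z, r - δ) ∈ K := by
    refine ⟨⟨hzs, sub_nonneg.2 (min_le_right _ _), by linarith [hr.2]⟩, fun i => ?_⟩
    have hz1 : z i ≤ 1 := (mem_Icc_of_mem_stdSimplex hzs i).2
    have h1 := hTz i
    have h2 : δ ≤ ε * (r - σ) / σ := min_le_left _ _
    change T z i + ε ≤ (r - δ) * z i
    nlinarith
  have := hmin hmem
  simp only [Set.mem_ofPred_eq] at this
  linarith

/-- **Nonlinear Perron–Frobenius theorem** for a monotone, positively homogeneous and continuous
self-map of the nonnegative orthant: a sub-eigenvector for the infimum of the numbers that admit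
a positive super-eigenvector. -/
lemma exists_cone_eigenvalue {ι : Type*} [Fintype ι] [Nonempty ι]
    {T : (ι → ℝ) → ι → ℝ} (hcont : Continuous T)
    (hmono : ∀ x y, 0 ≤ x → x ≤ y → T x ≤ T y)
    (hhom : ∀ (c : ℝ) (x : ι → ℝ), 0 ≤ c → 0 ≤ x → T (c • x) = c • T x) :
    ∃ r : ℝ, 0 ≤ r ∧ (∃ x : ι → ℝ, 0 ≤ x ∧ x ≠ 0 ∧ r • x ≤ T x) ∧
      ∀ s, r < s → ∃ y : ι → ℝ, (∀ i, 0 < y i) ∧ T y ≤ s • y := by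
  set A : Set ℝ := {s | 0 ≤ s ∧ ∃ y : ι → ℝ, (∀ i, 0 < y i) ∧ T y ≤ s • y} with hA
  have hbdd : BddBelow A := ⟨0, fun s hs => hs.1⟩
  -- Eigenvectors of `T + 1/(n+1)` have eigenvalues in `A`, hence at least `sInf A`. A limit point
  -- in the simplex is then a sub-eigenvector for `sInf A`.
  have key : ∀ n : ℕ, ∃ x : ι → ℝ, x ∈ stdSimplex ℝ ι ∧ (∃ s ∈ A,
      ∀ i, s * x i ≤ T x i + 1 / ((n : ℝ) + 1)) := fun n => by
    obtain ⟨s, x, hs, hx, hxs, h⟩ := exists_pos_eigenvector_add_const hcont hmono hhom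
      (ε := 1 / ((n : ℝ) + 1)) (by positivity)
    refine ⟨x, hxs, s, ⟨hs, x, hx, fun i => ?_⟩, fun i => (h i).ge⟩
    have : (0 : ℝ) < 1 / ((n : ℝ) + 1) := by positivity
    simp only [Pi.smul_apply, smul_eq_mul]
    linarith [h i]
  choose x hxs s hsA hx using key
  refine ⟨sInf A, le_csInf ⟨_, hsA 0⟩ fun s hs => hs.1, ?_, fun t ht => ?_⟩
  · obtain ⟨z, hz, φ, hφ, hlim⟩ := (isCompact_stdSimplex ℝ ι).tendsto_subseq hxs
    refine ⟨z, hz.1, ?_, fun i => ?_⟩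
    · rintro rfl
      simpa using hz.2
    · have h1 : Tendsto (fun n => sInf A * x (φ n) i) atTop (𝓝 (sInf A * z i)) :=
        (((continuous_apply i).tendsto z).comp hlim).const_mul _
      have h2 : Tendsto (fun n => T (x (φ n)) i + 1 / ((φ n : ℝ) + 1)) atTop (𝓝 (T z i + 0)) :=
        ((((continuous_apply i).comp hcont).tendsto z).comp hlim).add
          (tendsto_one_div_add_atTop_nhds_zero_nat.comp hφ.tendsto_atTop)
      rw [add_zero] at h2
      refine le_of_tendsto_of_tendsto' h1 h2 fun n => ?_
      exact (mul_le_mul_of_nonneg_right (csInf_le hbdd (hsA _)) ((hxs _).1 i)).trans (hx _ i)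
  · obtain ⟨s', ⟨hs0, y, hy, hTy⟩, hlt⟩ := exists_lt_of_csInf_lt ⟨_, hsA 0⟩ ht
    exact ⟨y, hy, hTy.trans fun i => mul_le_mul_of_nonneg_right hlt.le (hy i).le⟩

end Perron

/-! ### The value of `λ'_∞` -/

section LamInf

variable {S : Type*} [Fintype S] {M : ℕ}

/-- For a channel, `λ'_∞` is an eigenvalue of the Bellman operator
`x ↦ (min_m ∑ j, P i j * d j m * x j)_i`. -/
lemma lamInf_spec [DecidableEq S] [Nonempty S] [NeZero M] {P : Matrix S S ℝ} {d : S → Fin M → ℝ}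
    (hP : ∀ i j, 0 ≤ P i j) (hd : ∀ j m, 0 ≤ d j m) :
    0 ≤ lamInf P d ∧
    (∃ x : S → ℝ, 0 ≤ x ∧ x ≠ 0 ∧ ∀ i m, lamInf P d * x i ≤ ∑ j, P i j * d j m * x j) ∧
    ∀ s, lamInf P d < s → ∃ (y : S → ℝ) (v : S → Fin M), (∀ i, 0 < y i) ∧
      ∀ i, ∑ j, P i j * d j (v i) * y j ≤ s * y i := by
  set T : (S → ℝ) → S → ℝ := fun x i =>
    Finset.univ.inf' Finset.univ_nonempty fun m : Fin M => ∑ j, P i j * d j m * x j with hT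
  have hTle : ∀ x i m, T x i ≤ ∑ j, P i j * d j m * x j := fun x i m =>
    Finset.inf'_le _ (Finset.mem_univ m)
  have hTex : ∀ x i, ∃ m, T x i = ∑ j, P i j * d j m * x j := fun x i => by
    obtain ⟨m, -, hm⟩ := Finset.exists_mem_eq_inf' Finset.univ_nonempty
      fun m : Fin M => ∑ j, P i j * d j m * x j
    exact ⟨m, hm⟩
  have hcont : Continuous T := by
    refine continuous_pi fun i => Continuous.finset_inf'_apply _ fun m _ => ?_
    fun_prop
  obtain ⟨r, hr, ⟨x, hx, hx0, hrx⟩, hs⟩ := exists_cone_eigenvalue hcont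
    (fun x y _ hxy i => by
      obtain ⟨m, hm⟩ := hTex y i
      rw [hm]
      exact (hTle x i m).trans (Finset.sum_le_sum fun j _ =>
        mul_le_mul_of_nonneg_left (hxy j) (mul_nonneg (hP _ _) (hd _ _))))
    (fun c x hc _ => by
      have hsum : ∀ i m, ∑ j, P i j * d j m * (c • x) j = c * ∑ j, P i j * d j m * x j :=
        fun i m => by
          rw [Finset.mul_sum]
          exact Finset.sum_congr rfl fun j _ => by simp only [Pi.smul_apply, smul_eq_mul]; ring
      funext i
      refine le_antisymm ?_ ?_
      · obtain ⟨m, hm⟩ := hTex x i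
        have := hTle (c • x) i m
        rw [hsum] at this
        simpa [hm] using this
      · obtain ⟨m, hm⟩ := hTex (c • x) i
        rw [hm, hsum]
        exact mul_le_mul_of_nonneg_left (hTle x i m) hc)
  have hfail : ∀ (v : S → Fin M) (i j : S), 0 ≤ failMatrix P d v i j := fun v i j =>
    mul_nonneg (hP _ _) (hd _ _)
  have hsv : ∀ s, r < s → ∃ (y : S → ℝ) (v : S → Fin M), (∀ i, 0 < y i) ∧
      ∀ i, ∑ j, P i j * d j (v i) * y j ≤ s * y i := fun s hrs => by
    obtain ⟨y, hy, hTy⟩ := hs s hrs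
    -- The minimising channels of the separate rows combine into one `v`, since row `i` of the
    -- failure matrix involves `v i` only.
    choose v hv using hTex y
    exact ⟨y, v, hy, fun i => (hv i).symm.le.trans (hTy i)⟩
  have hxm : ∀ i m, r * x i ≤ ∑ j, P i j * d j m * x j := fun i m => (hrx i).trans (hTle x i m)
  -- Repeating one good `v` gives the upper bound; the common sub-eigenvector `x` gives the lower
  -- bound for every sequence.
  have hlam : ∀ L : ℕ, 0 < L → lam P d L = r := by
    intro L hL
    have hLr : (0 : ℝ) < L := by exact_mod_cast hL
    have hroot : ∀ s : ℝ, 0 ≤ s → (s ^ L) ^ (1 / (L : ℝ)) = s := fun s hs => by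
      rw [← Real.rpow_natCast, ← Real.rpow_mul hs, mul_one_div_cancel hLr.ne', Real.rpow_one]
    refine le_antisymm (le_of_forall_gt_imp_ge_of_dense fun s hrs => ?_) (le_ciInf fun v => ?_)
    · obtain ⟨y, v, hy, hyv⟩ := hsv s hrs
      have hs0 : 0 ≤ s := hr.trans hrs.le
      refine (ciInf_le ⟨0, ?_⟩ fun _ => v).trans ?_
      · rintro _ ⟨w, rfl⟩
        exact Real.rpow_nonneg (specRad_nonneg _) _
      · rw [← hroot s hs0]
        refine Real.rpow_le_rpow (specRad_nonneg _) ?_ (by positivity)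
        rw [List.ofFn_const, List.prod_replicate]
        refine specRad_le_of_mulVec_le_smul (pow_apply_nonneg (hfail v) L) hy (by positivity) ?_
        exact pow_mulVec_le_smul_pow (hfail v) hs0 (fun i => hyv i) L
    · rw [← hroot r hr]
      refine Real.rpow_le_rpow (by positivity) ?_ (by positivity)
      obtain ⟨h1, h2⟩ := list_prod_nonneg_and_smul_le hr
        (List.ofFn fun k => failMatrix P d (v k)) (x := x) (by
          intro B hB
          obtain ⟨k, rfl⟩ := (List.mem_ofFn' _ _).1 hB
          exact ⟨hfail _, fun i => hxm i _⟩)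
      rw [List.length_ofFn] at h2
      exact le_specRad_of_smul_le_mulVec h1 hx hx0 (by positivity) h2
  have hlamInf : lamInf P d = r := by
    refine (Tendsto.congr' ?_ tendsto_const_nhds : Tendsto (fun L => lam P d L) atTop
      (nhds r)).liminf_eq
    -- For `L = 0` the exponent `1 / L` is `0` and the value is `1`; the limit does not see it.
    filter_upwards [eventually_gt_atTop 0] with L hL using (hlam L hL).symm
  rw [hlamInf]
  exact ⟨hr, ⟨x, hx, hx0, hxm⟩, hsv⟩

end LamInf

/-! ### Growth of the error covariance between receptions -/

section Spectrum

open scoped Matrix.Norms.Operator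

variable {ι : Type*} [Fintype ι] [DecidableEq ι]

lemma norm_le_specRad_of_vecMul {A : Matrix ι ι ℝ} {lam : ℂ} {z : ι → ℂ} (hz : z ≠ 0)
    (h : z ᵥ* A.map Complex.ofReal = lam • z) : ‖lam‖ ≤ specRad A := by
  have hmem : lam ∈ spectrum ℂ (A.map Complex.ofReal) := by
    rw [spectrum.mem_iff, Matrix.isUnit_iff_isUnit_det, isUnit_iff_ne_zero, not_not,
      ← Matrix.exists_vecMul_eq_zero_iff]
    refine ⟨z, hz, ?_⟩
    rw [Matrix.vecMul_sub, h, Algebra.algebraMap_eq_smul_one, Matrix.vecMul_smul, Matrix.vecMul_one,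
      sub_self]
  have h1 : (‖lam‖₊ : ℝ≥0∞) ≤ spectralRadius ℂ (A.map Complex.ofReal) :=
    le_iSup₂ (f := fun k (_ : k ∈ spectrum ℂ (A.map Complex.ofReal)) => (‖k‖₊ : ℝ≥0∞)) lam hmem
  have h2 := ENNReal.toReal_mono (spectralRadius_map_ofReal_ne_top A) h1
  simpa [specRad] using h2

/-- Left eigenvectors are wanted because the form `cᵀ (A X Aᵀ) c` involves `cᵀ A`. -/
lemma exists_vecMul_eq_specRad {A : Matrix ι ι ℝ} (hA : 0 < specRad A) :
    ∃ (lam : ℂ) (z : ι → ℂ), z ≠ 0 ∧ z ᵥ* A.map Complex.ofReal = lam • z ∧ ‖lam‖ = specRad A := by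
  -- In dimension zero the spectrum is empty and `specRad` takes the value `0`.
  have hne : Nonempty ι := by
    by_contra hemp
    rw [not_nonempty_iff] at hemp
    simp [specRad, spectralRadius, spectrum.of_subsingleton] at hA
  obtain ⟨lam, hlam, hnorm⟩ := spectrum.exists_nnnorm_eq_spectralRadius (A.map Complex.ofReal)
  rw [spectrum.mem_iff, Matrix.isUnit_iff_isUnit_det, isUnit_iff_ne_zero, not_not,
      ← Matrix.exists_vecMul_eq_zero_iff] at hlam
  obtain ⟨z, hz, hzA⟩ := hlam
  refine ⟨lam, z, hz, ?_, ?_⟩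
  · rw [Matrix.vecMul_sub, Algebra.algebraMap_eq_smul_one, Matrix.vecMul_smul,
      Matrix.vecMul_one, sub_eq_zero] at hzA
    exact hzA.symm
  · rw [specRad, ← hnorm]
    simp

end Spectrum

section RealForm

variable {ι : Type*} [Fintype ι]

/-- Real and imaginary parts replace a complex eigenvector, so that the covariance forms stay real.
-/
lemma vecMul_map_ofReal_iff (A : Matrix ι ι ℝ) (lam : ℂ) (a b : ι → ℝ) :
    (fun i => (⟨a i, b i⟩ : ℂ)) ᵥ* A.map Complex.ofReal = lam • (fun i => (⟨a i, b i⟩ : ℂ)) ↔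
      a ᵥ* A = lam.re • a - lam.im • b ∧ b ᵥ* A = lam.im • a + lam.re • b := by
  have hre : ∀ j, ((fun i => (⟨a i, b i⟩ : ℂ)) ᵥ* A.map Complex.ofReal) j =
      ⟨(a ᵥ* A) j, (b ᵥ* A) j⟩ := fun j => by
    simp only [Matrix.vecMul, dotProduct, Matrix.map_apply]
    apply Complex.ext <;> simp
  simp only [funext_iff, hre, Complex.ext_iff, Pi.smul_apply, Pi.sub_apply, Pi.add_apply,
    smul_eq_mul, Complex.mul_re, Complex.mul_im]
  constructor
  · intro h
    exact ⟨fun i => (h i).1, fun i => by rw [(h i).2]; ring⟩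
  · rintro ⟨h1, h2⟩ i
    exact ⟨h1 i, by rw [h2]; ring⟩

/-- The sum of the values of a quadratic form at two vectors. -/
def quadSum (a b : ι → ℝ) (X : Matrix ι ι ℝ) : ℝ := a ⬝ᵥ X *ᵥ a + b ⬝ᵥ X *ᵥ b

lemma quadSum_add (a b : ι → ℝ) (X Y : Matrix ι ι ℝ) :
    quadSum a b (X + Y) = quadSum a b X + quadSum a b Y := by
  simp only [quadSum, Matrix.add_mulVec, dotProduct_add]; ring

lemma quadSum_nonneg (a b : ι → ℝ) {X : Matrix ι ι ℝ} (hX : X.PosSemidef) : 0 ≤ quadSum a b X := by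
  have h1 := hX.dotProduct_mulVec_nonneg a
  have h2 := hX.dotProduct_mulVec_nonneg b
  simp only [star_trivial] at h1 h2
  exact add_nonneg h1 h2

/-- `A` acts on the pair `(a, b)` as a rotation scaled by `|α + iβ|`; the cross terms cancel in the
sum of the two forms. -/
lemma quadSum_mul_mul_transpose {A : Matrix ι ι ℝ} {a b : ι → ℝ} {α β : ℝ}
    (ha : a ᵥ* A = α • a - β • b) (hb : b ᵥ* A = β • a + α • b) (X : Matrix ι ι ℝ) :
    quadSum a b (A * X * Aᵀ) = (α ^ 2 + β ^ 2) * quadSum a b X := by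
  have h : ∀ c : ι → ℝ, c ⬝ᵥ (A * X * Aᵀ) *ᵥ c = (c ᵥ* A) ⬝ᵥ X *ᵥ (c ᵥ* A) := fun c => by
    rw [← Matrix.mulVec_mulVec, ← Matrix.mulVec_mulVec, Matrix.dotProduct_mulVec,
      Matrix.mulVec_transpose]
  simp only [quadSum, h, ha, hb]
  simp only [Matrix.mulVec_add, Matrix.mulVec_sub, Matrix.mulVec_smul, add_dotProduct,
    sub_dotProduct, dotProduct_add, dotProduct_sub, smul_dotProduct, dotProduct_smul, smul_eq_mul]
  ring

open scoped MatrixOrder in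
-- Write `X = BᵀB` and apply Cauchy–Schwarz to each row of `B`.
lemma dotProduct_mulVec_le_trace_mul {X : Matrix ι ι ℝ} (hX : X.PosSemidef) (a : ι → ℝ) :
    a ⬝ᵥ X *ᵥ a ≤ X.trace * (a ⬝ᵥ a) := by
  classical
  obtain ⟨B, rfl⟩ := CStarAlgebra.nonneg_iff_eq_star_mul_self.mp hX.nonneg
  have h1 : a ⬝ᵥ (star B * B) *ᵥ a = (B *ᵥ a) ⬝ᵥ (B *ᵥ a) := by
    rw [← Matrix.mulVec_mulVec, Matrix.dotProduct_mulVec, Matrix.star_eq_conjTranspose,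
      Matrix.conjTranspose_eq_transpose_of_trivial, Matrix.vecMul_transpose]
  have h2 : (star B * B).trace = ∑ i, ∑ j, B i j ^ 2 := by
    rw [Finset.sum_comm]
    simp only [Matrix.trace, Matrix.diag, Matrix.mul_apply, Matrix.star_apply, star_trivial, sq]
  rw [h1, h2, dotProduct, Finset.sum_mul]
  refine Finset.sum_le_sum fun i _ => ?_
  rw [← sq]
  refine (Finset.sum_mul_sq_le_sq_mul_sq _ _ _).trans_eq ?_
  simp only [dotProduct, sq]

lemma quadSum_le_trace_mul {X : Matrix ι ι ℝ} (hX : X.PosSemidef) (a b : ι → ℝ) :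
    quadSum a b X ≤ X.trace * (a ⬝ᵥ a + b ⬝ᵥ b) := by
  rw [mul_add]
  exact add_le_add (dotProduct_mulVec_le_trace_mul hX a) (dotProduct_mulVec_le_trace_mul hX b)

end RealForm

/-! ### Two-sided bounds for the trace of the iterated prediction covariance -/

namespace LTI

variable {s : LTI} {X : Matrix (Fin s.l) (Fin s.l) ℝ}

lemma zeta_posSemidef (hX : X.PosSemidef) : (s.zeta X).PosSemidef := by
  have := (hX.mul_mul_conjTranspose_same s.A).add s.W_posSemidef
  rwa [Matrix.conjTranspose_eq_transpose_of_trivial] at this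

lemma zeta_iterate_posSemidef (hX : X.PosSemidef) (k : ℕ) : (s.zeta^[k] X).PosSemidef := by
  induction k with
  | zero => exact hX
  | succ k ih => rw [Function.iterate_succ_apply']; exact zeta_posSemidef ih

lemma innovCov_posSemidef (hX : X.PosSemidef) : (s.innovCov X).PosSemidef := by
  have := ((zeta_posSemidef hX).mul_mul_conjTranspose_same s.C).add s.V_posSemidef
  rwa [Matrix.conjTranspose_eq_transpose_of_trivial] at this

lemma IsSteadyState.innovCov_posDef (h : s.IsSteadyState X) : (s.innovCov X).PosDef :=
  (innovCov_posSemidef h.posSemidef).posDef_iff_isUnit.2 h.isUnit_innovCov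

lemma IsSteadyState.zeta_eq (h : s.IsSteadyState X) :
    s.zeta X = X + s.gain X * s.C * s.zeta X := by
  have := h.fixed
  rw [kalmanStep, sub_mul, one_mul, sub_eq_iff_eq_add] at this
  exact this

lemma zeta_transpose (hX : X.PosSemidef) : (s.zeta X)ᵀ = s.zeta X := by
  rw [← Matrix.conjTranspose_eq_transpose_of_trivial]
  exact (zeta_posSemidef hX).isHermitian

lemma vecMul_gain (hX : X.PosSemidef) (a : Fin s.l → ℝ) :
    a ᵥ* s.gain X = (s.C *ᵥ (s.zeta X *ᵥ a)) ᵥ* (s.innovCov X)⁻¹ := by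
  rw [gain, ← Matrix.vecMul_vecMul, ← Matrix.vecMul_vecMul, ← Matrix.mulVec_transpose (s.zeta X),
    zeta_transpose hX, Matrix.vecMul_transpose]

/-- The covariance removed by a measurement is `P⁻Cᵀ (C P⁻ Cᵀ + V)⁻¹ C P⁻`; its form vanishes at `c`
only if `C P⁻ c = 0`. -/
lemma quadSum_gain_mul (hX : X.PosSemidef) (a b : Fin s.l → ℝ) :
    quadSum a b (s.gain X * s.C * s.zeta X) =
      quadSum (s.C *ᵥ (s.zeta X *ᵥ a)) (s.C *ᵥ (s.zeta X *ᵥ b)) (s.innovCov X)⁻¹ := by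
  have h : ∀ c : Fin s.l → ℝ, c ⬝ᵥ (s.gain X * s.C * s.zeta X) *ᵥ c =
      (s.C *ᵥ (s.zeta X *ᵥ c)) ⬝ᵥ (s.innovCov X)⁻¹ *ᵥ (s.C *ᵥ (s.zeta X *ᵥ c)) := fun c => by
    rw [← Matrix.mulVec_mulVec, ← Matrix.mulVec_mulVec, Matrix.dotProduct_mulVec, vecMul_gain hX,
      ← Matrix.dotProduct_mulVec]
  simp only [quadSum, h]

/-- The expected squared error `k` steps after a reception grows at least like a geometric sum with
ratio `ρ(A)²`, because the filter is stable. -/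
lemma IsSteadyState.exists_mul_geom_sum_le_trace (h : s.IsSteadyState X) (hA : 1 ≤ specRad s.A) :
    ∃ ε : ℝ, 0 < ε ∧ ∀ k, ε * ∑ i ∈ Finset.range k, (specRad s.A ^ 2) ^ i ≤
      (s.zeta^[k] X).trace := by
  have hX := h.posSemidef
  obtain ⟨lam, z, hz, hzA, hlam⟩ := exists_vecMul_eq_specRad (zero_lt_one.trans_le hA)
  obtain ⟨a, b, rfl⟩ : ∃ a b : Fin s.l → ℝ, z = fun i => (⟨a i, b i⟩ : ℂ) :=
    ⟨fun i => (z i).re, fun i => (z i).im, rfl⟩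
  obtain ⟨ha, hb⟩ := (vecMul_map_ofReal_iff _ _ _ _).1 hzA
  have hsq : lam.re ^ 2 + lam.im ^ 2 = specRad s.A ^ 2 := by
    rw [← hlam, Complex.sq_norm, Complex.normSq_apply]; ring
  set δ := quadSum a b (s.gain X * s.C * s.zeta X) with hδ
  have hSpos : ((s.innovCov X)⁻¹).PosDef := h.innovCov_posDef.inv
  -- If `δ = 0`, then `C P⁻` kills both parts of the left eigenvector `z`, hence `zᵀ K = 0`. So `z`
  -- is also a left eigenvector of `(I - KC)A` with an eigenvalue of modulus at least one, against
  -- filter stability.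
  have hδpos : 0 < δ := by
    have hnn : 0 ≤ δ := by
      rw [hδ, quadSum_gain_mul hX]
      exact quadSum_nonneg _ _ hSpos.posSemidef
    refine lt_of_le_of_ne hnn fun h0 => ?_
    rw [hδ, quadSum_gain_mul hX] at h0
    set a' := s.C *ᵥ (s.zeta X *ᵥ a) with ha'
    set b' := s.C *ᵥ (s.zeta X *ᵥ b) with hb'
    have hpos : ∀ c : Fin s.r → ℝ, 0 ≤ c ⬝ᵥ (s.innovCov X)⁻¹ *ᵥ c := fun c => by
      simpa using hSpos.posSemidef.dotProduct_mulVec_nonneg c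
    have hzero : ∀ c : Fin s.r → ℝ, c ⬝ᵥ (s.innovCov X)⁻¹ *ᵥ c = 0 → c = 0 := fun c hc => by
      by_contra hne
      have := hSpos.dotProduct_mulVec_pos hne
      simp only [star_trivial] at this
      exact this.ne' hc
    rw [quadSum] at h0
    have ha0 : a' = 0 := hzero _ (by linarith [hpos a', hpos b'])
    have hb0 : b' = 0 := hzero _ (by linarith [hpos a', hpos b'])
    have hcl : ∀ c : Fin s.l → ℝ, s.C *ᵥ (s.zeta X *ᵥ c) = 0 →
        c ᵥ* ((1 - s.gain X * s.C) * s.A) = c ᵥ* s.A := fun c hc => by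
      rw [← Matrix.vecMul_vecMul, Matrix.vecMul_sub, Matrix.vecMul_one, ← Matrix.vecMul_vecMul,
        vecMul_gain hX, hc, Matrix.zero_vecMul, Matrix.zero_vecMul, sub_zero]
    have hev := norm_le_specRad_of_vecMul hz ((vecMul_map_ofReal_iff _ lam a b).2
      ⟨(hcl a ha0).trans ha, (hcl b hb0).trans hb⟩)
    linarith [h.stable]
  have hstep : ∀ Y, quadSum a b (s.zeta Y) = specRad s.A ^ 2 * quadSum a b Y + quadSum a b s.W :=
    fun Y => by rw [zeta, quadSum_add, quadSum_mul_mul_transpose ha hb, hsq]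
  -- The first increment is `δ` by the fixed-point equation, and the affine recursion multiplies
  -- each later increment by `ρ²`.
  have hdiff : ∀ k, quadSum a b (s.zeta^[k + 1] X) - quadSum a b (s.zeta^[k] X) =
      (specRad s.A ^ 2) ^ k * δ := by
    intro k
    induction k with
    | zero =>
      have := congrArg (quadSum a b) h.zeta_eq
      rw [quadSum_add] at this
      simp only [Function.iterate_succ, Function.comp, Function.iterate_zero, id]
      rw [this, hδ]; ring
    | succ k ih =>
      rw [Function.iterate_succ_apply', hstep, Function.iterate_succ_apply' _ k, hstep]
      rw [Function.iterate_succ_apply', hstep] at ih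
      rw [pow_succ]
      linear_combination specRad s.A ^ 2 * ih
  have hlow : ∀ k, δ * ∑ i ∈ Finset.range k, (specRad s.A ^ 2) ^ i ≤
      quadSum a b (s.zeta^[k] X) := by
    intro k
    induction k with
    | zero => simpa using quadSum_nonneg a b hX
    | succ k ih =>
      rw [Finset.sum_range_succ, mul_add]
      linarith [hdiff k]
  have hnorm : 0 < a ⬝ᵥ a + b ⬝ᵥ b := by
    have h1 : 0 ≤ a ⬝ᵥ a := dotProduct_self_star_nonneg a
    have h2 : 0 ≤ b ⬝ᵥ b := dotProduct_self_star_nonneg b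
    refine lt_of_le_of_ne (add_nonneg h1 h2) fun h0 => hz ?_
    have ha0 : a = 0 := dotProduct_self_eq_zero.1 (by linarith)
    have hb0 : b = 0 := dotProduct_self_eq_zero.1 (by linarith)
    funext i
    simp [ha0, hb0, Complex.ext_iff]
  refine ⟨δ / (a ⬝ᵥ a + b ⬝ᵥ b), by positivity, fun k => ?_⟩
  rw [div_mul_eq_mul_div, div_le_iff₀ hnorm]
  exact (hlow k).trans (quadSum_le_trace_mul (zeta_iterate_posSemidef hX k) a b)

lemma zeta_iterate_eq (k : ℕ) : s.zeta^[k] X = s.A ^ k * X * (s.A ^ k)ᵀ +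
    ∑ i ∈ Finset.range k, s.A ^ i * s.W * (s.A ^ i)ᵀ := by
  induction k with
  | zero => simp
  | succ k ih =>
    rw [Function.iterate_succ_apply', ih, zeta, mul_add, add_mul, Finset.mul_sum, Finset.sum_mul,
      Finset.sum_range_succ', add_assoc]
    simp only [pow_succ', Matrix.transpose_mul, pow_zero, Matrix.transpose_one, mul_one, one_mul,
      Matrix.mul_assoc]

open scoped Matrix.Norms.Operator in
-- Submultiplicativity and `‖A^i‖ ≤ c q^i` bound each term of the expanded iterate; the factors
-- `s.l` pay for the trace and for transposing in the row-sum norm.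
lemma exists_trace_le_geom_sum (X : Matrix (Fin s.l) (Fin s.l) ℝ) {q : ℝ} (hq : specRad s.A < q) :
    ∃ c : ℝ, 0 < c ∧ ∀ k, (s.zeta^[k] X).trace ≤
      c * ((q ^ 2) ^ k + ∑ i ∈ Finset.range k, (q ^ 2) ^ i) := by
  obtain ⟨c, hc, hcA⟩ := exists_norm_pow_le_of_specRad_lt s.A hq
  have htr : ∀ Y : Matrix (Fin s.l) (Fin s.l) ℝ, Y.trace ≤ s.l * ‖Y‖ := fun Y => by
    calc Y.trace ≤ ∑ _i : Fin s.l, ‖Y‖ :=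
          Finset.sum_le_sum fun i _ => (le_abs_self _).trans (abs_apply_le_linfty_norm Y i i)
      _ = s.l * ‖Y‖ := by simp
  have htp : ∀ Y : Matrix (Fin s.l) (Fin s.l) ℝ, ‖Yᵀ‖ ≤ s.l * ‖Y‖ := fun Y => by
    refine linfty_norm_le (by positivity) fun i => ?_
    calc ∑ j, |Yᵀ i j| ≤ ∑ _j : Fin s.l, ‖Y‖ :=
          Finset.sum_le_sum fun j _ => abs_apply_le_linfty_norm Y j i
      _ = s.l * ‖Y‖ := by simp
  have hbd : ∀ (i : ℕ) (Y : Matrix (Fin s.l) (Fin s.l) ℝ),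
      (s.A ^ i * Y * (s.A ^ i)ᵀ).trace ≤ s.l ^ 2 * c ^ 2 * ‖Y‖ * (q ^ 2) ^ i := fun i Y => by
    have h0 : ‖s.A ^ i‖ ^ 2 ≤ (c * q ^ i) ^ 2 := pow_le_pow_left₀ (norm_nonneg _) (hcA i) 2
    calc (s.A ^ i * Y * (s.A ^ i)ᵀ).trace ≤ s.l * ‖s.A ^ i * Y * (s.A ^ i)ᵀ‖ := htr _
      _ ≤ s.l * (‖s.A ^ i‖ * ‖Y‖ * (s.l * ‖s.A ^ i‖)) := by
          gcongr
          exact (norm_mul_le _ _).trans (mul_le_mul (norm_mul_le _ _) (htp _) (by positivity)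
            (by positivity))
      _ = s.l ^ 2 * ‖Y‖ * ‖s.A ^ i‖ ^ 2 := by ring
      _ ≤ s.l ^ 2 * ‖Y‖ * (c * q ^ i) ^ 2 := by gcongr
      _ = _ := by ring
  refine ⟨s.l ^ 2 * c ^ 2 * (‖X‖ + ‖s.W‖) + 1, by positivity, fun k => ?_⟩
  rw [zeta_iterate_eq, Matrix.trace_add, Matrix.trace_sum, mul_add, Finset.mul_sum]
  refine add_le_add ((hbd k X).trans ?_) (Finset.sum_le_sum fun i _ => (hbd i s.W).trans ?_)
  · refine mul_le_mul_of_nonneg_right ?_ (by positivity)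
    nlinarith [mul_nonneg (mul_nonneg (sq_nonneg (s.l : ℝ)) (sq_nonneg c)) (norm_nonneg s.W)]
  · refine mul_le_mul_of_nonneg_right ?_ (by positivity)
    nlinarith [mul_nonneg (mul_nonneg (sq_nonneg (s.l : ℝ)) (sq_nonneg c)) (norm_nonneg X)]

lemma exists_trace_le_pow (X : Matrix (Fin s.l) (Fin s.l) ℝ) {θ : ℝ} (hθ1 : 1 < θ)
    (hθ : specRad s.A ^ 2 < θ) :
    ∃ c : ℝ, 0 < c ∧ ∀ k, (s.zeta^[k] X).trace ≤ c * θ ^ k := by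
  -- Take `q = √θ`; since `θ > 1`, the geometric sum is itself of order `θ^k`.
  obtain ⟨c, hc, h⟩ := exists_trace_le_geom_sum X (Real.lt_sqrt_of_sq_lt hθ)
  rw [Real.sq_sqrt (by linarith)] at h
  have h1 : 0 < θ - 1 := by linarith
  refine ⟨c * (1 + (θ - 1)⁻¹), by positivity, fun k => (h k).trans ?_⟩
  rw [geom_sum_eq hθ1.ne', mul_assoc]
  refine mul_le_mul_of_nonneg_left ?_ hc.le
  rw [add_mul, one_mul, div_eq_inv_mul]
  have : (θ - 1)⁻¹ * (θ ^ k - 1) ≤ (θ - 1)⁻¹ * θ ^ k :=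
    mul_le_mul_of_nonneg_left (by linarith) (by positivity)
  linarith

lemma exists_trace_le_const (X : Matrix (Fin s.l) (Fin s.l) ℝ) (hA : specRad s.A < 1) :
    ∃ c : ℝ, 0 < c ∧ ∀ k, (s.zeta^[k] X).trace ≤ c := by
  obtain ⟨q, hq, hq1⟩ := exists_between hA
  have hq0 : 0 ≤ q := (specRad_nonneg s.A).trans hq.le
  obtain ⟨c, hc, h⟩ := exists_trace_le_geom_sum X hq
  have hqq : q ^ 2 < 1 := by nlinarith
  have h1 : 0 < 1 - q ^ 2 := by linarith
  refine ⟨c * (1 + (1 - q ^ 2)⁻¹), by positivity, fun k => (h k).trans ?_⟩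
  refine mul_le_mul_of_nonneg_left (add_le_add (pow_le_one₀ (by positivity) hqq.le) ?_) hc.le
  rw [← tsum_geometric_of_lt_one (by positivity) hqq]
  exact (summable_geometric_of_lt_one (by positivity) hqq).sum_le_tsum _ fun i _ => by positivity

end LTI

/-! ### Centered random vectors with a given covariance matrix -/

section HasCov

variable {Ω : Type*} [MeasurableSpace Ω] {μ : Measure Ω} {ι κ : Type*}

/-- A square-integrable centered random vector with covariance matrix `S`. -/
structure HasCov (μ : Measure Ω) (X : Ω → EuclideanSpace ℝ ι) (S : Matrix ι ι ℝ) : Prop where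
  memLp : ∀ i, MemLp (fun ω => X ω i) 2 μ
  mean : ∀ i, ∫ ω, X ω i ∂μ = 0
  cov : ∀ i j, ∫ ω, X ω i * X ω j ∂μ = S i j

/-- Gaussian laws enter only here; afterwards only the first two moments and independence are used.
-/
lemma HasCov.of_hasLaw [Fintype ι] [DecidableEq ι] {X : Ω → EuclideanSpace ℝ ι} {S : Matrix ι ι ℝ}
    (hS : S.PosSemidef) (h : HasLaw X (multivariateGaussian 0 S) μ) : HasCov μ X S := by
  have hL : ∀ i, MemLp (fun x : EuclideanSpace ℝ ι => x i) 2 (multivariateGaussian 0 S) :=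
    fun i => IsGaussian.memLp_dual (multivariateGaussian 0 S)
      (EuclideanSpace.proj i : EuclideanSpace ℝ ι →L[ℝ] ℝ) 2 (by simp)
  have hmean : ∀ i, ∫ x : EuclideanSpace ℝ ι, x i ∂multivariateGaussian 0 S = 0 := fun i => by
    have := (EuclideanSpace.proj i : EuclideanSpace ℝ ι →L[ℝ] ℝ).integral_comp_comm
      (IsGaussian.integrable_id (μ := multivariateGaussian 0 S))
    simpa using this
  refine ⟨fun i => ?_, fun i => ?_, fun i j => ?_⟩
  · have := hL i
    rw [← h.map_eq] at this
    exact this.comp_of_map h.aemeasurable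
  · have := h.integral_comp (f := fun x => x i) (by fun_prop)
    exact this.trans (hmean i)
  · have h1 := h.integral_comp (f := fun x => x i * x j) (by fun_prop)
    have h2 := covariance_eval_multivariateGaussian (μ := 0) hS i j
    rw [covariance_eq_sub (hL i) (hL j), hmean i, zero_mul, sub_zero] at h2
    exact h1.trans h2

lemma HasCov.integrable [IsFiniteMeasure μ] {X : Ω → EuclideanSpace ℝ ι} {S : Matrix ι ι ℝ}
    (h : HasCov μ X S) (i : ι) : Integrable (fun ω => X ω i) μ :=
  (h.memLp i).integrable (by norm_num)

lemma HasCov.integrable_mul {X : Ω → EuclideanSpace ℝ ι} {S : Matrix ι ι ℝ}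
    (h : HasCov μ X S) (i j : ι) : Integrable (fun ω => X ω i * X ω j) μ :=
  (h.memLp i).integrable_mul (h.memLp j)

lemma HasCov.toEuclideanLin [Fintype ι] [DecidableEq ι] [IsFiniteMeasure μ] {X : Ω → EuclideanSpace ℝ ι}
    {S : Matrix ι ι ℝ} (h : HasCov μ X S) (A : Matrix κ ι ℝ) :
    HasCov μ (fun ω => A.toEuclideanLin (X ω)) (A * S * Aᵀ) := by
  have hA : ∀ ω k, (A.toEuclideanLin (X ω)) k = ∑ i, A k i * X ω i := fun ω k => rfl
  refine ⟨fun k => ?_, fun k => ?_, fun k l => ?_⟩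
  · simp only [hA]
    exact memLp_finsetSum _ fun i _ => (h.memLp i).const_mul _
  · simp only [hA]
    rw [integral_finsetSum _ fun i _ => (h.integrable i).const_mul _]
    simp [integral_const_mul, h.mean]
  · have : ∀ ω, (A.toEuclideanLin (X ω)) k * (A.toEuclideanLin (X ω)) l =
        ∑ i, ∑ j, A k i * A l j * (X ω i * X ω j) := fun ω => by
      rw [hA, hA, Finset.sum_mul_sum]
      exact Finset.sum_congr rfl fun i _ => Finset.sum_congr rfl fun j _ => by ring
    simp only [this]
    rw [integral_finsetSum _ fun i _ => integrable_finsetSum _ fun j _ =>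
      (h.integrable_mul i j).const_mul _]
    simp_rw [integral_finsetSum _ fun j _ => (h.integrable_mul _ j).const_mul _,
      integral_const_mul, h.cov]
    rw [Matrix.mul_apply]
    simp only [Matrix.mul_apply, Matrix.transpose_apply, Finset.sum_mul]
    rw [Finset.sum_comm]
    exact Finset.sum_congr rfl fun i _ => Finset.sum_congr rfl fun j _ => by ring

lemma HasCov.neg {X : Ω → EuclideanSpace ℝ ι} {S : Matrix ι ι ℝ} (h : HasCov μ X S) :
    HasCov μ (fun ω => - X ω) S := by
  refine ⟨fun i => (h.memLp i).neg, fun i => ?_, fun i j => ?_⟩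
  · simp only [PiLp.neg_apply, integral_neg, h.mean, neg_zero]
  · simp only [PiLp.neg_apply, neg_mul_neg, h.cov]

lemma HasCov.add [Fintype ι] [IsFiniteMeasure μ] {X Y : Ω → EuclideanSpace ℝ ι} {S S' : Matrix ι ι ℝ}
    (hX : HasCov μ X S) (hY : HasCov μ Y S') (hXY : IndepFun X Y μ) :
    HasCov μ (fun ω => X ω + Y ω) (S + S') := by
  have hcross : ∀ i j, ∫ ω, X ω i * Y ω j ∂μ = 0 := fun i j => by
    have hind : IndepFun (fun ω => X ω i) (fun ω => Y ω j) μ :=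
      hXY.comp (φ := fun x : EuclideanSpace ℝ ι => x i) (ψ := fun x : EuclideanSpace ℝ ι => x j)
        (by fun_prop) (by fun_prop)
    rw [hind.integral_fun_mul_eq_mul_integral (hX.memLp i).1 (hY.memLp j).1, hX.mean, zero_mul]
  have hint : ∀ i j, Integrable (fun ω => X ω i * Y ω j) μ := fun i j =>
    (hX.memLp i).integrable_mul (hY.memLp j)
  refine ⟨fun i => (hX.memLp i).add (hY.memLp i), fun i => ?_, fun i j => ?_⟩
  · simp only [PiLp.add_apply]
    rw [integral_add (hX.integrable i) (hY.integrable i), hX.mean, hY.mean, add_zero]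
  · have : ∀ ω, (X ω + Y ω) i * (X ω + Y ω) j =
        (X ω i * X ω j + Y ω i * Y ω j) + (X ω i * Y ω j + X ω j * Y ω i) := fun ω => by
      simp only [PiLp.add_apply]; ring
    have h1 : Integrable (fun ω => X ω i * X ω j + Y ω i * Y ω j) μ :=
      (hX.integrable_mul i j).add (hY.integrable_mul i j)
    have h2 : Integrable (fun ω => X ω i * Y ω j + X ω j * Y ω i) μ := (hint i j).add (by
      simpa only [mul_comm] using hint j i)
    simp only [this]
    rw [integral_add h1 h2, integral_add (hX.integrable_mul i j) (hY.integrable_mul i j),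
      integral_add (hint i j) (hint j i), hcross, hcross, hX.cov, hY.cov, Matrix.add_apply]
    ring

lemma HasCov.sub [Fintype ι] [IsFiniteMeasure μ] {X Y : Ω → EuclideanSpace ℝ ι} {S S' : Matrix ι ι ℝ}
    (hX : HasCov μ X S) (hY : HasCov μ Y S') (hXY : IndepFun X Y μ) :
    HasCov μ (fun ω => X ω - Y ω) (S + S') := by
  have := hX.add hY.neg (hXY.comp measurable_id measurable_neg)
  simpa only [sub_eq_add_neg] using this

lemma HasCov.lintegral_norm_sq [Fintype ι] {X : Ω → EuclideanSpace ℝ ι} {S : Matrix ι ι ℝ}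
    (h : HasCov μ X S) : ∫⁻ ω, ENNReal.ofReal (‖X ω‖ ^ 2) ∂μ = ENNReal.ofReal S.trace := by
  have hsq : ∀ ω, ‖X ω‖ ^ 2 = ∑ i, X ω i * X ω i := fun ω => by
    rw [EuclideanSpace.real_norm_sq_eq]
    simp only [sq]
  rw [← ofReal_integral_eq_lintegral_ofReal]
  · simp only [hsq]
    rw [integral_finsetSum _ fun i _ => h.integrable_mul i i]
    simp only [h.cov]
    rfl
  · simp only [hsq]
    exact integrable_finsetSum _ fun i _ => h.integrable_mul i i
  · exact ae_of_all _ fun ω => by positivity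

lemma indepFun_of_measurable_of_indep {β γ : Type*} [MeasurableSpace β] [MeasurableSpace γ]
    {m₁ m₂ : MeasurableSpace Ω} (h : Indep m₁ m₂ μ) {X : Ω → β} {Y : Ω → γ}
    (hX : Measurable[m₁] X) (hY : Measurable[m₂] Y) : IndepFun X Y μ :=
  (IndepFun_iff_Indep X Y μ).2 (indep_of_indep_of_le h hX.comap_le hY.comap_le)

lemma measurable_toEuclideanLin [Fintype ι] [Fintype κ] [DecidableEq ι] (A : Matrix κ ι ℝ) :
    Measurable fun x : EuclideanSpace ℝ ι => A.toEuclideanLin x :=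
  (LinearMap.continuous_of_finiteDimensional A.toEuclideanLin).measurable

end HasCov

/-- In steady state the covariance of the filter error reproduces itself. -/
lemma LTI.IsSteadyState.joseph {s : LTI} {X : Matrix (Fin s.l) (Fin s.l) ℝ}
    (h : s.IsSteadyState X) :
    (1 - s.gain X * s.C) * s.zeta X * (1 - s.gain X * s.C)ᵀ + s.gain X * s.V * (s.gain X)ᵀ = X := by
  have hdet : IsUnit (s.innovCov X).det :=
    (Matrix.isUnit_iff_isUnit_det _).1 h.isUnit_innovCov
  have hK : s.gain X * s.innovCov X = s.zeta X * s.Cᵀ := by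
    rw [LTI.gain, Matrix.mul_assoc, Matrix.nonsing_inv_mul _ hdet, Matrix.mul_one]
  have hfix := h.fixed
  rw [LTI.kalmanStep] at hfix
  -- With `(I - KC)P⁻ = X`, the left side of the goal is `X - X CᵀKᵀ + K V Kᵀ`, and `X Cᵀ = K V`
  -- cancels the last two terms.
  have hXC : X * s.Cᵀ = s.gain X * s.V := by
    calc X * s.Cᵀ = (1 - s.gain X * s.C) * s.zeta X * s.Cᵀ := by rw [hfix]
      _ = s.zeta X * s.Cᵀ - s.gain X * (s.C * s.zeta X * s.Cᵀ) := by
          rw [Matrix.sub_mul, Matrix.sub_mul, Matrix.one_mul]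
          simp only [Matrix.mul_assoc]
      _ = s.gain X * s.V := by
          rw [← hK, LTI.innovCov, Matrix.mul_add, add_sub_cancel_left]
  rw [hfix, Matrix.transpose_sub, Matrix.transpose_one, Matrix.transpose_mul, Matrix.mul_sub,
    Matrix.mul_one, ← Matrix.mul_assoc, hXC, sub_add_cancel]

/-! ### Covariances of the local and predicted errors, and their separation from the channel -/

namespace Realization

variable {N M : ℕ} {S : Type*} [Fintype S] [DecidableEq S] {sys : Fin N → LTI}
  {Pbar : (n : Fin N) → Matrix (Fin (sys n).l) (Fin (sys n).l) ℝ}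
  {P : Matrix S S ℝ} {d : S → Fin M → ℝ} {a : Fin N → ℕ}
  {Ω : Type*} [MeasurableSpace Ω] {μ : Measure Ω}
  (R : Realization sys Pbar P d a μ)

/-- The σ-algebra generated by one of the independent sources of randomness. -/
@[reducible]
def sourceSigma : Source N → MeasurableSpace Ω
  | .init n => MeasurableSpace.comap (R.x₀ n) inferInstance ⊔
        MeasurableSpace.comap (R.xs₀ n) inferInstance ⊔
        MeasurableSpace.comap (R.xhat₀ n) inferInstance
  | .proc n t => MeasurableSpace.comap (R.w n t) inferInstance
  | .meas n t => MeasurableSpace.comap (R.v n (t + 1)) inferInstance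
  | .chan => (⨆ t, MeasurableSpace.comap (R.h t) ⊤) ⊔
        ⨆ t, MeasurableSpace.comap (R.drop t) inferInstance

lemma iIndep_sourceSigma : iIndep R.sourceSigma μ := by
  have h := R.indep
  refine (congrArg (fun f => iIndep f μ) ?_).mp h
  funext s
  cases s <;> rfl

lemma comap_h_le (t : ℕ) : MeasurableSpace.comap (R.h t) ⊤ ≤ ‹MeasurableSpace Ω› := by
  rintro _ ⟨s, -, rfl⟩
  have : R.h t ⁻¹' s = ⋃ j ∈ s, {ω | R.h t ω = j} := by ext; simp
  rw [this]
  exact MeasurableSet.biUnion (Set.to_countable s) fun j _ => R.measurable_h t j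

lemma sourceSigma_le (s : Source N) : R.sourceSigma s ≤ ‹MeasurableSpace Ω› := by
  cases s with
  | init n =>
    exact sup_le (sup_le (R.measurable_x₀ n).comap_le (R.measurable_xs₀ n).comap_le)
      (R.measurable_xhat₀ n).comap_le
  | proc n t => exact (R.measurable_w n t).comap_le
  | meas n t => exact (R.measurable_v n (t + 1)).comap_le
  | chan => exact sup_le (iSup_le R.comap_h_le) (iSup_le fun t => (R.measurable_drop t).comap_le)

/-- The sources of process `n` that are revealed before slot `t`. -/
def pastSources (n : Fin N) (t : ℕ) : Set (Source N) :=
  {s | s = .init n ∨ ∃ k < t, s = .proc n k ∨ s = .meas n k}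

/-- The σ-algebra generated by the sources in `I`. -/
@[reducible]
def sigma (I : Set (Source N)) : MeasurableSpace Ω := ⨆ s ∈ I, R.sourceSigma s

lemma sigma_mono {I J : Set (Source N)} (h : I ⊆ J) : R.sigma I ≤ R.sigma J :=
  biSup_mono h

lemma sourceSigma_le_sigma {I : Set (Source N)} {s : Source N} (h : s ∈ I) :
    R.sourceSigma s ≤ R.sigma I := le_biSup R.sourceSigma h

lemma sigma_le (I : Set (Source N)) : R.sigma I ≤ ‹MeasurableSpace Ω› :=
  iSup₂_le fun s _ => R.sourceSigma_le s

lemma indep_sigma {I J : Set (Source N)} (h : Disjoint I J) : Indep (R.sigma I) (R.sigma J) μ :=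
  indep_iSup_of_disjoint R.sourceSigma_le R.iIndep_sourceSigma h

lemma pastSources_mono (n : Fin N) {t t' : ℕ} (h : t ≤ t') :
    pastSources n t ⊆ pastSources n t' := by
  rintro s (hs | ⟨k, hk, hs⟩)
  · exact Or.inl hs
  · exact Or.inr ⟨k, hk.trans_le h, hs⟩

/-- The estimation error of the local Kalman filter. -/
def localErr (n : Fin N) (t : ℕ) (ω : Ω) : EuclideanSpace ℝ (Fin (sys n).l) :=
  R.xs n t ω - R.x n t ω

/-- The error of the `k`-step prediction made at time `s` from an estimate with error `X`. -/
def predErr (n : Fin N) (s : ℕ) (X : Ω → EuclideanSpace ℝ (Fin (sys n).l)) :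
    ℕ → Ω → EuclideanSpace ℝ (Fin (sys n).l)
  | 0, ω => X ω
  | k + 1, ω => (sys n).A.toEuclideanLin (predErr n s X k ω) - R.w n (s + k) ω

lemma measurable_w_sigma (n : Fin N) {t : ℕ} {I : Set (Source N)} (h : Source.proc n t ∈ I) :
    Measurable[R.sigma I] (R.w n t) :=
  measurable_iff_comap_le.2 (R.sourceSigma_le_sigma h)

lemma measurable_v_sigma (n : Fin N) {t : ℕ} {I : Set (Source N)} (h : Source.meas n t ∈ I) :
    Measurable[R.sigma I] (R.v n (t + 1)) :=
  measurable_iff_comap_le.2 (R.sourceSigma_le_sigma h)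

lemma measurable_predErr (n : Fin N) (s : ℕ) {X : Ω → EuclideanSpace ℝ (Fin (sys n).l)}
    (hX : Measurable[R.sigma (pastSources n s)] X) (k : ℕ) :
    Measurable[R.sigma (pastSources n (s + k))] (R.predErr n s X k) := by
  induction k with
  | zero => exact hX
  | succ k ih =>
    have h1 := ih.mono (R.sigma_mono (pastSources_mono n (by omega : s + k ≤ s + (k + 1)))) le_rfl
    have h2 : Measurable[R.sigma (pastSources n (s + (k + 1)))] (R.w n (s + k)) :=
      R.measurable_w_sigma n (Or.inr ⟨s + k, by omega, Or.inl rfl⟩)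
    exact ((measurable_toEuclideanLin _).comp h1).sub h2

lemma indepFun_past_w (n : Fin N) (t : ℕ) {X : Ω → EuclideanSpace ℝ (Fin (sys n).l)}
    (hX : Measurable[R.sigma (pastSources n t)] X) : IndepFun X (R.w n t) μ := by
  refine indepFun_of_measurable_of_indep (R.indep_sigma (J := {Source.proc n t}) ?_) hX
    (R.measurable_w_sigma n (Set.mem_singleton _))
  rw [Set.disjoint_singleton_right]
  rintro (h | ⟨k, hk, h | h⟩)
  · cases h
  · cases h; omega
  · cases h

/-- The noise of slot `s + k` is independent of the sources revealed before, so each prediction step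
adds `W`. -/
lemma hasCov_predErr [IsProbabilityMeasure μ] (n : Fin N) (s : ℕ)
    {X : Ω → EuclideanSpace ℝ (Fin (sys n).l)}
    {C : Matrix (Fin (sys n).l) (Fin (sys n).l) ℝ}
    (hX : Measurable[R.sigma (pastSources n s)] X) (hC : HasCov μ X C) (k : ℕ) :
    HasCov μ (R.predErr n s X k) ((sys n).zeta^[k] C) := by
  induction k with
  | zero => exact hC
  | succ k ih =>
    rw [Function.iterate_succ_apply']
    refine (ih.toEuclideanLin (sys n).A).sub
      (HasCov.of_hasLaw (sys n).W_posSemidef (R.law_w n (s + k))) ?_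
    exact R.indepFun_past_w n (s + k)
      ((measurable_toEuclideanLin _).comp (R.measurable_predErr n s hX k))

/-- The innovation is `v(t+1)` minus `C` times the prediction error, which puts the update in Joseph
form. -/
lemma localErr_succ (n : Fin N) (t : ℕ) (ω : Ω) : R.localErr n (t + 1) ω =
    (1 - (sys n).gain (Pbar n) * (sys n).C).toEuclideanLin
      (R.predErr n t (R.localErr n t) 1 ω) +
    ((sys n).gain (Pbar n)).toEuclideanLin (R.v n (t + 1) ω) := by
  simp only [localErr, predErr, xs, x, y, map_sub, map_add, Matrix.toLpLin_mul_same,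
    LinearMap.sub_apply, LinearMap.comp_apply, Matrix.toLpLin_one, LinearMap.id_apply, add_zero]
  abel

lemma localErr_spec [IsProbabilityMeasure μ]
    (hP : ∀ n, (sys n).IsSteadyState (Pbar n)) (n : Fin N) (t : ℕ) :
    Measurable[R.sigma (pastSources n t)] (R.localErr n t) ∧
      HasCov μ (R.localErr n t) (Pbar n) := by
  induction t with
  | zero =>
    refine ⟨?_, HasCov.of_hasLaw (hP n).posSemidef (R.law_xs₀ n)⟩
    have h : R.sourceSigma (.init n) ≤ R.sigma (pastSources n 0) :=
      R.sourceSigma_le_sigma (Or.inl rfl)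
    have h1 : Measurable[R.sigma (pastSources n 0)] (R.xs₀ n) :=
      measurable_iff_comap_le.2 ((le_sup_right.trans le_sup_left).trans h)
    have h2 : Measurable[R.sigma (pastSources n 0)] (R.x₀ n) :=
      measurable_iff_comap_le.2 ((le_sup_left.trans le_sup_left).trans h)
    exact h1.sub h2
  | succ t ih =>
    set G := 1 - (sys n).gain (Pbar n) * (sys n).C with hG
    set K := (sys n).gain (Pbar n) with hK
    have heq : R.localErr n (t + 1) = fun ω =>
        G.toEuclideanLin (R.predErr n t (R.localErr n t) 1 ω) +
          K.toEuclideanLin (R.v n (t + 1) ω) := funext fun ω => R.localErr_succ n t ω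
    -- `I` contains the process noise of slot `t` but not `meas n t`, which labels `v (t + 1)`; so
    -- the prediction error is independent of the new measurement noise.
    set I : Set (Source N) := insert (Source.proc n t) (pastSources n t) with hI
    have hXm : Measurable[R.sigma I] (R.predErr n t (R.localErr n t) 1) := by
      have h1 := ih.1.mono (R.sigma_mono (Set.subset_insert (Source.proc n t) _)) le_rfl
      exact ((measurable_toEuclideanLin _).comp h1).sub
        (R.measurable_w_sigma n (t := t) (Set.mem_insert _ _))
    have hIsub : I ⊆ pastSources n (t + 1) := Set.insert_subset
      (Or.inr ⟨t, by omega, Or.inl rfl⟩) (pastSources_mono n (Nat.le_succ t))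
    have hvm : ∀ J : Set (Source N), Source.meas n t ∈ J →
        Measurable[R.sigma J] fun ω => K.toEuclideanLin (R.v n (t + 1) ω) := fun J hJ =>
      (measurable_toEuclideanLin K).comp (R.measurable_v_sigma n hJ)
    have hGm : ∀ J : Set (Source N), I ⊆ J → Measurable[R.sigma J] fun ω =>
        G.toEuclideanLin (R.predErr n t (R.localErr n t) 1 ω) := fun J hJ =>
      (measurable_toEuclideanLin G).comp (hXm.mono (R.sigma_mono hJ) le_rfl)
    rw [heq]
    refine ⟨(hGm _ hIsub).add (hvm _ (Or.inr ⟨t, by omega, Or.inr rfl⟩)), ?_⟩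
    have hcov := ((R.hasCov_predErr n t ih.1 ih.2 1).toEuclideanLin G).add
      ((HasCov.of_hasLaw (sys n).V_posSemidef (R.law_v n (t + 1))).toEuclideanLin K) ?_
    · have hj := (hP n).joseph
      rwa [Function.iterate_one, hj] at hcov
    · refine indepFun_of_measurable_of_indep (R.indep_sigma (I := I) (J := {Source.meas n t}) ?_)
        (hGm I subset_rfl) (hvm _ (Set.mem_singleton _))
      rw [Set.disjoint_singleton_right]
      rintro (h | h | ⟨k, hk, h | h⟩)
      · cases h
      · cases h
      · cases h
      · cases h; omega

/-! ### Ages of information and the channel history -/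

/-- One step of the ages of information. -/
def _root_.RemoteEst.Policy.ageStep (π : Policy N M S) (φ : Fin N → ℕ) (i : S) (b : Fin M → Bool)
    (n : Fin N) : ℕ :=
  open Classical in if ∃ m, π.select φ i n = some m ∧ b m = false then 1 else φ n + 1

lemma age_succ (π : Policy N M S) (t : ℕ) (ω : Ω) :
    R.age π (t + 1) ω = π.ageStep (R.age π t ω) (R.h t ω) (R.drop t ω) := rfl

/-- The channel states up to the one before slot `t` and the packet drops before slot `t`. -/
@[reducible]
def hist (t : ℕ) : MeasurableSpace Ω :=
  (⨆ k ∈ Set.Iic t, MeasurableSpace.comap (R.h k) ⊤) ⊔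
      ⨆ k ∈ Set.Iio t, MeasurableSpace.comap (R.drop k) inferInstance

lemma hist_mono {t t' : ℕ} (h : t ≤ t') : R.hist t ≤ R.hist t' :=
  sup_le_sup (biSup_mono fun _ hk => le_trans hk h) (biSup_mono fun _ hk => lt_of_lt_of_le hk h)

lemma hist_le_chan (t : ℕ) : R.hist t ≤ R.sourceSigma .chan :=
  sup_le_sup (iSup₂_le fun k _ => le_iSup (fun k => MeasurableSpace.comap (R.h k) ⊤) k)
    (iSup₂_le fun k _ => le_iSup (fun k => MeasurableSpace.comap (R.drop k) inferInstance) k)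

lemma hist_le (t : ℕ) : R.hist t ≤ ‹MeasurableSpace Ω› :=
  (R.hist_le_chan t).trans (R.sourceSigma_le _)

lemma measurableSet_hist_h (t : ℕ) (i : S) : MeasurableSet[R.hist t] {ω | R.h t ω = i} := by
  have h : MeasurableSpace.comap (R.h t) ⊤ ≤ R.hist t :=
    le_trans (le_biSup (fun k => MeasurableSpace.comap (R.h k) ⊤) (Set.mem_Iic.2 le_rfl))
      le_sup_left
  exact h _ ⟨{i}, trivial, rfl⟩

lemma measurableSet_hist_drop (t : ℕ) (b : Fin M → Bool) :
    MeasurableSet[R.hist (t + 1)] {ω | R.drop t ω = b} := by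
  have h : MeasurableSpace.comap (R.drop t) inferInstance ≤ R.hist (t + 1) :=
    le_trans (le_biSup (fun k => MeasurableSpace.comap (R.drop k) inferInstance)
      (Set.mem_Iio.2 (Nat.lt_succ_self t))) le_sup_right
  exact h _ ⟨{b}, MeasurableSet.singleton b, rfl⟩

lemma measurableSet_hist_age (π : Policy N M S) (t : ℕ) (φ : Fin N → ℕ) :
    MeasurableSet[R.hist t] {ω | R.age π t ω = φ} := by
  induction t generalizing φ with
  | zero =>
    by_cases h : a = φ
    · have : {ω | R.age π 0 ω = φ} = Set.univ := by
        ext ω; exact iff_of_true h trivial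
      rw [this]; exact @MeasurableSet.univ _ (R.hist 0)
    · have : {ω | R.age π 0 ω = φ} = ∅ := by
        ext ω; exact iff_of_false h id
      rw [this]; exact @MeasurableSet.empty _ (R.hist 0)
  | succ t ih =>
    have : {ω | R.age π (t + 1) ω = φ} =
        ⋃ p ∈ {p : (Fin N → ℕ) × S × (Fin M → Bool) | π.ageStep p.1 p.2.1 p.2.2 = φ},
          {ω | R.age π t ω = p.1} ∩ {ω | R.h t ω = p.2.1} ∩ {ω | R.drop t ω = p.2.2} := by
      ext ω
      simp only [Set.mem_iUnion, exists_prop]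
      constructor
      · intro h
        exact ⟨(R.age π t ω, R.h t ω, R.drop t ω), h, ⟨rfl, rfl⟩, rfl⟩
      · rintro ⟨⟨φ', i, b⟩, hp, ⟨h1, h2⟩, h3⟩
        change R.age π (t + 1) ω = φ
        rw [age_succ, show R.age π t ω = φ' from h1, show R.h t ω = i from h2,
          show R.drop t ω = b from h3]
        exact hp
    rw [this]
    have hle := R.hist_mono (Nat.le_succ t)
    exact MeasurableSet.biUnion (Set.to_countable _) fun p _ =>
      ((hle _ (ih p.1)).inter (hle _ (R.measurableSet_hist_h t p.2.1))).inter
        (R.measurableSet_hist_drop t p.2.2)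

lemma age_pos (ha : ∀ n, 1 ≤ a n) (π : Policy N M S) (t : ℕ) (ω : Ω) (n : Fin N) :
    1 ≤ R.age π t ω n := by
  cases t with
  | zero => exact ha n
  | succ t =>
    rw [age_succ, Policy.ageStep]
    split_ifs <;> omega

/-- Either a packet has been received and the age counts from that slot, or none has and the initial
age has grown undisturbed. These are the two branches of `errOfAge`. -/
lemma age_le_or_eq (π : Policy N M S) (t : ℕ) (ω : Ω) (n : Fin N) :
    R.age π t ω n ≤ t ∨ R.age π t ω n = a n + t := by
  induction t with
  | zero => exact Or.inr rfl
  | succ t ih =>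
    rw [age_succ, Policy.ageStep]
    split_ifs <;> omega

/-! ### The mean-square error as a function of the age -/

/-- The prediction error of process `n` in slot `t` if its age of information is `k`. -/
def errOfAge (n : Fin N) (t k : ℕ) : Ω → EuclideanSpace ℝ (Fin (sys n).l) :=
  if k ≤ t then R.predErr n (t - k) (R.localErr n (t - k)) k
  else R.predErr n 0 (fun ω => R.xhat₀ n ω - R.x₀ n ω) t

/-- The policy and the channel influence the error only through the age, which selects one of the
vectors `errOfAge n t k`. -/
lemma xhat_sub_x (ha : ∀ n, 1 ≤ a n) (π : Policy N M S) (n : Fin N) (t : ℕ) (ω : Ω) :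
    R.xhat π n t ω - R.x n t ω = R.errOfAge n t (R.age π t ω n) ω := by
  induction t with
  | zero =>
    have : ¬ R.age π 0 ω n ≤ 0 := by have := R.age_pos ha π 0 ω n; omega
    rw [errOfAge, if_neg this]
    rfl
  | succ t ih =>
    by_cases hr : R.Received π n t ω
    · have hage : R.age π (t + 1) ω n = 1 := by
        rw [age_succ, Policy.ageStep]
        exact if_pos hr
      rw [hage, errOfAge, if_pos (by omega)]
      simp only [Nat.add_sub_cancel, predErr, xhat, x, if_pos hr, localErr, map_sub, add_zero]
      abel
    · have hage : R.age π (t + 1) ω n = R.age π t ω n + 1 := by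
        rw [age_succ, Policy.ageStep]
        exact if_neg hr
      have hx : R.xhat π n (t + 1) ω - R.x n (t + 1) ω =
          (sys n).A.toEuclideanLin (R.xhat π n t ω - R.x n t ω) - R.w n t ω := by
        simp only [xhat, x, if_neg hr, map_sub]
        abel
      rw [hx, ih, hage]
      by_cases hle : R.age π t ω n ≤ t
      · rw [errOfAge, errOfAge, if_pos hle, if_pos (by omega), Nat.add_sub_add_right]
        simp only [predErr]
        rw [Nat.sub_add_cancel hle]
      · rw [errOfAge, errOfAge, if_neg hle, if_neg (by omega)]
        simp only [predErr, zero_add]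

lemma _root_.RemoteEst.lintegral_eq_tsum_fiber {Ω : Type*} [MeasurableSpace Ω] {μ : Measure Ω}
    {κ : Type*} [Countable κ] (f : Ω → κ)
    (hf : ∀ k, MeasurableSet {ω | f ω = k}) (g : Ω → ℝ≥0∞) :
    ∫⁻ ω, g ω ∂μ = ∑' k, ∫⁻ ω in {ω | f ω = k}, g ω ∂μ := by
  rw [← lintegral_iUnion hf]
  · have : (⋃ k, {ω | f ω = k}) = Set.univ := by
      ext ω
      simp only [Set.mem_iUnion, Set.mem_univ, iff_true]
      exact ⟨f ω, rfl⟩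
    rw [this, setLIntegral_univ]
  · intro k l hkl
    refine Set.disjoint_left.2 fun ω h1 h2 => hkl ?_
    exact (show f ω = k from h1).symm.trans h2

lemma errOfAge_spec [IsProbabilityMeasure μ] (hP : ∀ n, (sys n).IsSteadyState (Pbar n))
    (n : Fin N) {t k : ℕ} (hk : k ≤ t ∨ k = a n + t) :
    Measurable[R.sigma (pastSources n t)] (R.errOfAge n t k) ∧
      ∫⁻ ω, ENNReal.ofReal (‖R.errOfAge n t k ω‖ ^ 2) ∂μ =
        ENNReal.ofReal ((sys n).zeta^[k] (Pbar n)).trace := by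
  by_cases h : k ≤ t
  · rw [errOfAge, if_pos h]
    obtain ⟨h1, h2⟩ := R.localErr_spec hP n (t - k)
    have h3 := R.measurable_predErr n (t - k) h1 k
    rw [Nat.sub_add_cancel h] at h3
    exact ⟨h3, (R.hasCov_predErr n (t - k) h1 h2 k).lintegral_norm_sq⟩
  · rw [errOfAge, if_neg h]
    obtain rfl : k = a n + t := hk.resolve_left h
    have hle : R.sourceSigma (.init n) ≤ R.sigma (pastSources n 0) :=
      R.sourceSigma_le_sigma (Or.inl rfl)
    have h1 : Measurable[R.sigma (pastSources n 0)] (R.xhat₀ n) :=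
      measurable_iff_comap_le.2 (le_sup_right.trans hle)
    have h2 : Measurable[R.sigma (pastSources n 0)] (R.x₀ n) :=
      measurable_iff_comap_le.2 ((le_sup_left.trans le_sup_left).trans hle)
    have h3 := R.measurable_predErr n 0 (h1.sub h2) t
    rw [zero_add] at h3
    have h4 := R.hasCov_predErr n 0 (h1.sub h2) (HasCov.of_hasLaw
      (LTI.zeta_iterate_posSemidef (hP n).posSemidef (a n)) (R.law_xhat₀ n)) t
    rw [← Function.iterate_add_apply, add_comm t] at h4
    exact ⟨h3, h4.lintegral_norm_sq⟩

/-- The mean-square error is the mean of `tr ζ^φ(P̄)`, where `φ` is the age of information. -/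
lemma mse_eq [IsProbabilityMeasure μ] (hP : ∀ n, (sys n).IsSteadyState (Pbar n))
    (ha : ∀ n, 1 ≤ a n) (π : Policy N M S) (n : Fin N) (t : ℕ) :
    R.mse π n t =
      ∫⁻ ω, ENNReal.ofReal ((sys n).zeta^[R.age π t ω n] (Pbar n)).trace ∂μ := by
  have hfib : ∀ k, MeasurableSet[R.hist t] {ω | R.age π t ω n = k} := fun k => by
    have : {ω | R.age π t ω n = k} = ⋃ φ ∈ {φ : Fin N → ℕ | φ n = k}, {ω | R.age π t ω = φ} := by
      ext ω
      simp only [Set.mem_iUnion, exists_prop]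
      constructor
      · intro h
        exact ⟨_, h, rfl⟩
      · rintro ⟨φ, h1, h2⟩
        change R.age π t ω n = k
        rw [show R.age π t ω = φ from h2]
        exact h1
    rw [this]
    exact MeasurableSet.biUnion (Set.to_countable _) fun φ _ => R.measurableSet_hist_age π t φ
  have hfib' := fun k => R.hist_le t _ (hfib k)
  -- On the event that the age is `k` the error equals `errOfAge n t k`. That vector depends on the
  -- sources of process `n`, the event on the channel; by independence the expectation factorises.
  rw [mse, lintegral_eq_tsum_fiber (fun ω => R.age π t ω n) hfib',
    lintegral_eq_tsum_fiber (fun ω => R.age π t ω n) hfib']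
  refine tsum_congr fun k => ?_
  have hL : ∫⁻ ω in {ω | R.age π t ω n = k}, ENNReal.ofReal (‖R.xhat π n t ω - R.x n t ω‖ ^ 2) ∂μ =
      ∫⁻ ω in {ω | R.age π t ω n = k}, ENNReal.ofReal (‖R.errOfAge n t k ω‖ ^ 2) ∂μ :=
    setLIntegral_congr_fun (hfib' k) fun ω hω => by
      have h2 : R.age π t ω n = k := hω
      simp only [R.xhat_sub_x ha π n t ω, h2]
  have hRt : ∫⁻ ω in {ω | R.age π t ω n = k},
        ENNReal.ofReal ((sys n).zeta^[R.age π t ω n] (Pbar n)).trace ∂μ =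
      ∫⁻ _ in {ω | R.age π t ω n = k}, ENNReal.ofReal ((sys n).zeta^[k] (Pbar n)).trace ∂μ :=
    setLIntegral_congr_fun (hfib' k) fun ω hω => by
      have h2 : R.age π t ω n = k := hω
      simp only [h2]
  rw [hL, hRt, setLIntegral_const]
  by_cases hk : k ≤ t ∨ k = a n + t
  · obtain ⟨hm, hint⟩ := R.errOfAge_spec hP n hk
    rw [← hint, ← lintegral_indicator (hfib' k)]
    have hI : Indep (R.sigma (pastSources n t)) (R.sigma {.chan}) μ := by
      refine R.indep_sigma ?_
      rw [Set.disjoint_singleton_right]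
      rintro (h | ⟨k, hk, h | h⟩) <;> cases h
    have hchan : R.hist t ≤ R.sigma {.chan} :=
      (R.hist_le_chan t).trans (R.sourceSigma_le_sigma (Set.mem_singleton _))
    have hf : Measurable[R.sigma (pastSources n t)]
        fun ω => ENNReal.ofReal (‖R.errOfAge n t k ω‖ ^ 2) := by
      have hφ : Measurable fun x : EuclideanSpace ℝ (Fin (sys n).l) =>
        ENNReal.ofReal (‖x‖ ^ 2) := by fun_prop
      exact hφ.comp hm
    have hg : Measurable[R.sigma {.chan}]
        ({ω | R.age π t ω n = k}.indicator fun _ => (1 : ℝ≥0∞)) :=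
      measurable_const.indicator (hchan _ (hfib k))
    have := lintegral_mul_eq_lintegral_mul_lintegral_of_independent_measurableSpace
      (R.sigma_le _) (R.sigma_le _) hI hf hg
    rw [lintegral_indicator_const (hfib' k), one_mul] at this
    rw [← this]
    refine lintegral_congr fun ω => ?_
    by_cases hω : ω ∈ {ω | R.age π t ω n = k}
    · rw [Set.indicator_of_mem hω, Set.indicator_of_mem hω, mul_one]
    · rw [Set.indicator_of_notMem hω, Set.indicator_of_notMem hω, mul_zero]
  · have hemp : {ω | R.age π t ω n = k} = ∅ := by
      ext ω
      refine iff_of_false (fun h => hk ?_) id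
      have h2 : R.age π t ω n = k := h
      rw [← h2]
      exact R.age_le_or_eq π t ω n
    rw [hemp]
    simp

end Realization

/-! ### Expectations over one slot of the channel -/

namespace Realization

variable {N M : ℕ} {S : Type*} [Fintype S] [DecidableEq S] {sys : Fin N → LTI}
  {Pbar : (n : Fin N) → Matrix (Fin (sys n).l) (Fin (sys n).l) ℝ}
  {P : Matrix S S ℝ} {d : S → Fin M → ℝ} {a : Fin N → ℕ}
  {Ω : Type*} [MeasurableSpace Ω] {μ : Measure Ω}
  (R : Realization sys Pbar P d a μ)

lemma setLIntegral_comp_h {D : Set Ω} (t : ℕ) (F : S → ℝ≥0∞) :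
    ∫⁻ ω in D, F (R.h t ω) ∂μ = ∑ j, μ (D ∩ {ω | R.h t ω = j}) * F j := by
  rw [lintegral_eq_tsum_fiber (R.h t) (R.measurable_h t), tsum_fintype]
  refine Finset.sum_congr rfl fun j _ => ?_
  rw [setLIntegral_congr_fun (R.measurable_h t j) (g := fun _ => F j), setLIntegral_const,
    Measure.restrict_apply (R.measurable_h t j), mul_comm, Set.inter_comm]
  intro ω hω
  have h2 : R.h t ω = j := hω
  simp only [h2]

lemma setLIntegral_next {t : ℕ} {B : Set Ω} (hB : MeasurableSet[R.hist t] B) (i : S)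
    (F : S → ℝ≥0∞) :
    ∫⁻ ω in B ∩ {ω | R.h t ω = i}, F (R.h (t + 1) ω) ∂μ =
      μ (B ∩ {ω | R.h t ω = i}) * ∑ j, ENNReal.ofReal (P i j) * F j := by
  rw [R.setLIntegral_comp_h, Finset.mul_sum]
  refine Finset.sum_congr rfl fun j _ => ?_
  rw [← mul_assoc, ← R.law_h t B hB i j, Set.inter_assoc]
  rfl

/-- The weights are row `i` of `failMatrix P d v` with `v i = m`; both drift estimates rest on this
identity. -/
lemma setLIntegral_drop {t : ℕ} {B : Set Ω} (hB : MeasurableSet[R.hist t] B) (i : S) (m : Fin M)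
    (F : S → ℝ≥0∞) :
    ∫⁻ ω in B ∩ {ω | R.h t ω = i} ∩ {ω | R.drop t ω m = true}, F (R.h (t + 1) ω) ∂μ =
      μ (B ∩ {ω | R.h t ω = i}) *
        ∑ j, ENNReal.ofReal (P i j) * ENNReal.ofReal (d j m) * F j := by
  rw [R.setLIntegral_comp_h, Finset.mul_sum]
  refine Finset.sum_congr rfl fun j _ => ?_
  rw [← mul_assoc, ← mul_assoc, ← R.law_h t B hB i j, ← R.law_drop t B hB i j m]
  congr 2
  ext ω
  constructor
  · rintro ⟨⟨⟨h1, h2⟩, h3⟩, h4⟩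
    exact ⟨h1, h2, h4, h3⟩
  · rintro ⟨h1, h2, h4, h3⟩
    exact ⟨⟨⟨h1, h2⟩, h3⟩, h4⟩

lemma measurableSet_drop (t : ℕ) (m : Fin M) : MeasurableSet {ω | R.drop t ω m = true} :=
  measurableSet_eq_fun ((measurable_pi_apply m).comp (R.measurable_drop t)) measurable_const

/-- The event that in slot `t` the ages are `φ` and the last known channel state is `i`. -/
def cell (π : Policy N M S) (t : ℕ) (φ : Fin N → ℕ) (i : S) : Set Ω :=
  {ω | R.age π t ω = φ} ∩ {ω | R.h t ω = i}

lemma measurableSet_cell (π : Policy N M S) (t : ℕ) (φ : Fin N → ℕ) (i : S) :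
    MeasurableSet (R.cell π t φ i) :=
  (R.hist_le t _ (R.measurableSet_hist_age π t φ)).inter (R.measurable_h t i)

lemma lintegral_eq_tsum_cell (π : Policy N M S) (t : ℕ) (g : Ω → ℝ≥0∞) :
    ∫⁻ ω, g ω ∂μ = ∑' p : (Fin N → ℕ) × S, ∫⁻ ω in R.cell π t p.1 p.2, g ω ∂μ := by
  have : ∀ p : (Fin N → ℕ) × S, {ω | (R.age π t ω, R.h t ω) = p} = R.cell π t p.1 p.2 := by
    rintro ⟨φ, i⟩
    ext ω
    exact Prod.mk_inj
  rw [lintegral_eq_tsum_fiber (fun ω => (R.age π t ω, R.h t ω)) (fun p => ?_)]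
  · simp only [this]
  · rw [this]
    exact R.measurableSet_cell π t p.1 p.2

lemma lintegral_age_h (π : Policy N M S) (t : ℕ) (G : (Fin N → ℕ) → S → ℝ≥0∞) :
    ∫⁻ ω, G (R.age π t ω) (R.h t ω) ∂μ =
      ∑' p : (Fin N → ℕ) × S, μ (R.cell π t p.1 p.2) * G p.1 p.2 := by
  rw [R.lintegral_eq_tsum_cell π t]
  refine tsum_congr fun p => ?_
  rw [setLIntegral_congr_fun (R.measurableSet_cell π t p.1 p.2) (g := fun _ => G p.1 p.2),
    setLIntegral_const, mul_comm]
  rintro ω ⟨h1, h2⟩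
  have h1' : R.age π t ω = p.1 := h1
  have h2' : R.h t ω = p.2 := h2
  simp only [h1', h2']

lemma lintegral_h_succ (hP : ∀ i j, 0 ≤ P i j) (t : ℕ) {f : S → ℝ} (hf : 0 ≤ f) :
    ∫⁻ ω, ENNReal.ofReal (f (R.h (t + 1) ω)) ∂μ =
      ∫⁻ ω, ENNReal.ofReal ((P *ᵥ f) (R.h t ω)) ∂μ := by
  rw [lintegral_eq_tsum_fiber (R.h t) (R.measurable_h t),
    lintegral_eq_tsum_fiber (R.h t) (R.measurable_h t)]
  refine tsum_congr fun i => ?_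
  have h1 := R.setLIntegral_next (@MeasurableSet.univ _ (R.hist t)) i
    fun j => ENNReal.ofReal (f j)
  rw [Set.univ_inter] at h1
  rw [h1, setLIntegral_congr_fun (R.measurable_h t i)
    (g := fun _ => ENNReal.ofReal ((P *ᵥ f) i)), setLIntegral_const, mul_comm]
  · congr 1
    rw [Matrix.mulVec, dotProduct, ENNReal.ofReal_sum_of_nonneg fun j _ => mul_nonneg (hP _ _)
      (hf j)]
    exact Finset.sum_congr rfl fun j _ => (ENNReal.ofReal_mul (hP _ _)).symm
  · intro ω hω
    have h2 : R.h t ω = i := hω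
    simp only [h2]

lemma lintegral_h_add (hP : ∀ i j, 0 ≤ P i j) (t k : ℕ) {f : S → ℝ} (hf : 0 ≤ f) :
    ∫⁻ ω, ENNReal.ofReal (f (R.h (t + k) ω)) ∂μ =
      ∫⁻ ω, ENNReal.ofReal ((P ^ k *ᵥ f) (R.h t ω)) ∂μ := by
  induction k generalizing f with
  | zero => simp
  | succ k ih =>
    rw [← add_assoc, R.lintegral_h_succ hP (t + k) hf, ih, Matrix.mulVec_mulVec, ← pow_succ]
    exact fun i => Finset.sum_nonneg fun j _ => mul_nonneg (hP _ _) (hf j)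

end Realization

/-! ### Scheduling the oldest packet first -/

section OldestFirst

variable {N : ℕ}

/-- An injective priority that refines the order of the ages. -/
def priority (φ : Fin N → ℕ) (n : Fin N) : ℕ := φ n * N + n

lemma priority_injective (φ : Fin N → ℕ) : Function.Injective (priority φ) := by
  intro n m h
  have h1 := congrArg (· % N) h
  simp only [priority, Nat.mul_add_mod_self_right, Nat.mod_eq_of_lt n.isLt,
    Nat.mod_eq_of_lt m.isLt] at h1
  exact Fin.ext h1

lemma exists_oldest [NeZero N] (φ : Fin N → ℕ) : ∃ n, ∀ m, priority φ m ≤ priority φ n :=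
  Finite.exists_max (priority φ)

/-- The process with the highest priority. -/
def oldest [NeZero N] (φ : Fin N → ℕ) : Fin N := (exists_oldest φ).choose

lemma priority_le_oldest [NeZero N] (φ : Fin N → ℕ) (m : Fin N) :
    priority φ m ≤ priority φ (oldest φ) := (exists_oldest φ).choose_spec m

/-- The number of processes with a higher priority. -/
def rank (φ : Fin N → ℕ) (n : Fin N) : ℕ :=
  (Finset.univ.filter fun m => priority φ n < priority φ m).card

lemma rank_le (φ : Fin N → ℕ) (n : Fin N) : rank φ n ≤ N :=
  (Finset.card_le_univ _).trans_eq (Fintype.card_fin N)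

lemma priority_add_one (φ : Fin N → ℕ) (n : Fin N) :
    priority (fun m => φ m + 1) n = priority φ n + N := by
  simp only [priority]; ring

lemma rank_add_one (φ : Fin N → ℕ) (n : Fin N) : rank (fun m => φ m + 1) n = rank φ n := by
  simp only [rank, priority_add_one, add_lt_add_iff_right]

/-- After the age of the oldest process is reset, all other processes move up by one. -/
lemma rank_reset_lt [NeZero N] {φ : Fin N → ℕ} (hφ : ∀ n, 1 ≤ φ n) {n : Fin N}
    (hn : n ≠ oldest φ) :
    rank (fun m => if m = oldest φ then 1 else φ m + 1) n < rank φ n := by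
  set ψ : Fin N → ℕ := fun m => if m = oldest φ then 1 else φ m + 1 with hψ
  have hne : ∀ m, m ≠ oldest φ → priority ψ m = priority φ m + N := fun m hm => by
    rw [← priority_add_one, priority, priority, hψ]
    simp only [if_neg hm]
  -- The reset process has age one, so its priority is below `2N`, while every other priority is now
  -- at least `2N`: the oldest process drops to the bottom and the rest keep their order.
  have hold : priority ψ (oldest φ) < N + N := by
    have h1 : ψ (oldest φ) = 1 := if_pos rfl
    rw [priority, h1, one_mul]
    exact Nat.add_lt_add_left (oldest φ).isLt N
  have hge : N ≤ priority φ n :=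
    (Nat.le_mul_of_pos_left N (hφ n)).trans (Nat.le_add_right _ _)
  refine Finset.card_lt_card ⟨fun m hm => ?_, fun hsub => ?_⟩
  · rw [Finset.mem_filter] at hm ⊢
    refine ⟨Finset.mem_univ m, ?_⟩
    have h := hm.2
    rw [hne n hn] at h
    by_cases hmo : m = oldest φ
    · rw [hmo] at h; omega
    · rw [hne m hmo] at h; omega
  · have hmem : oldest φ ∈ Finset.univ.filter fun m => priority φ n < priority φ m := by
      rw [Finset.mem_filter]
      exact ⟨Finset.mem_univ _, lt_of_le_of_ne (priority_le_oldest φ n)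
        fun h => hn (priority_injective φ h)⟩
    have h := (Finset.mem_filter.1 (hsub hmem)).2
    rw [hne n hn] at h
    omega

/-- A weighted exponential moment of the ages. -/
def ageWeight (θ L : ℝ) (φ : Fin N → ℕ) : ℝ := ∑ n, θ ^ φ n * L ^ rank φ n

lemma ageWeight_nonneg {θ L : ℝ} (hθ : 0 ≤ θ) (hL : 0 ≤ L) (φ : Fin N → ℕ) :
    0 ≤ ageWeight θ L φ := Finset.sum_nonneg fun _ _ => by positivity

lemma pow_le_ageWeight {θ L : ℝ} (hθ : 0 ≤ θ) (hL : 1 ≤ L) (φ : Fin N → ℕ) (n : Fin N) :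
    θ ^ φ n ≤ ageWeight θ L φ := by
  have hL0 : 0 ≤ L := zero_le_one.trans hL
  calc θ ^ φ n ≤ θ ^ φ n * L ^ rank φ n :=
        le_mul_of_one_le_right (by positivity) (one_le_pow₀ hL)
    _ ≤ ageWeight θ L φ := Finset.single_le_sum (f := fun n => θ ^ φ n * L ^ rank φ n)
        (fun _ _ => by positivity) (Finset.mem_univ n)

lemma ageWeight_add_one (θ L : ℝ) (φ : Fin N → ℕ) :
    ageWeight θ L (fun n => φ n + 1) = θ * ageWeight θ L φ := by
  rw [ageWeight, ageWeight, Finset.mul_sum]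
  exact Finset.sum_congr rfl fun n _ => by rw [rank_add_one, pow_succ]; ring

/-- The reset process contributes at most `θ L^N`; every other term gains a factor `θ` by ageing and
loses at least a factor `L` by moving up in rank. -/
lemma ageWeight_reset_le [NeZero N] {θ L : ℝ} (hθ : 0 ≤ θ) (hL : 1 ≤ L) {φ : Fin N → ℕ}
    (hφ : ∀ n, 1 ≤ φ n) :
    ageWeight θ L (fun m => if m = oldest φ then 1 else φ m + 1) ≤
      θ * L ^ N + θ / L * ageWeight θ L φ := by
  have hL0 : 0 < L := zero_lt_one.trans_le hL
  have hsum : θ * L ^ N + θ / L * ageWeight θ L φ =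
      ∑ n, ((if n = oldest φ then θ * L ^ N else 0) + θ / L * (θ ^ φ n * L ^ rank φ n)) := by
    rw [Finset.sum_add_distrib, ← Finset.mul_sum, Finset.sum_ite_eq' Finset.univ,
      if_pos (Finset.mem_univ _)]
    rfl
  rw [hsum]
  refine Finset.sum_le_sum fun n _ => ?_
  by_cases h : n = oldest φ
  · simp only [if_pos h, pow_one]
    have h1 : θ * L ^ rank (fun m => if m = oldest φ then 1 else φ m + 1) n ≤ θ * L ^ N :=
      mul_le_mul_of_nonneg_left (pow_le_pow_right₀ hL (rank_le _ _)) hθ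
    have h2 : 0 ≤ θ / L * (θ ^ φ n * L ^ rank φ n) := by positivity
    linarith
  · simp only [if_neg h, zero_add]
    have h1 := pow_le_pow_right₀ hL (Nat.succ_le_of_lt (rank_reset_lt hφ h))
    rw [pow_succ] at h1
    have h2 : L ^ rank (fun m => if m = oldest φ then 1 else φ m + 1) n ≤ L ^ rank φ n / L :=
      (le_div_iff₀ hL0).2 h1
    calc θ ^ (φ n + 1) * L ^ rank (fun m => if m = oldest φ then 1 else φ m + 1) n
        ≤ θ ^ (φ n + 1) * (L ^ rank φ n / L) := by gcongr
      _ = _ := by rw [pow_succ]; ring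

/-- The policy that sends the packet of the oldest process in channel `v i`, where `i` is the last
known channel state. -/
def oldestFirst [NeZero N] {M : ℕ} {S : Type*} (v : S → Fin M) : Policy N M S where
  select φ i n := if n = oldest φ then some (v i) else none
  injective φ i n n' m h h' := by
    by_contra hne
    by_cases h1 : n = oldest φ
    · rw [if_neg (fun h2 => hne (h1.trans h2.symm))] at h'
      exact absurd h' (by simp)
    · rw [if_neg h1] at h
      exact absurd h (by simp)

lemma ageStep_oldestFirst [NeZero N] {M : ℕ} {S : Type*} (v : S → Fin M) (φ : Fin N → ℕ) (i : S)
    (b : Fin M → Bool) : (oldestFirst v).ageStep φ i b =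
      if b (v i) = true then fun n => φ n + 1
      else fun n => if n = oldest φ then 1 else φ n + 1 := by
  funext n
  simp only [Policy.ageStep, oldestFirst]
  by_cases h1 : n = oldest φ <;> by_cases h2 : b (v i) = true <;> simp [h1, h2]

end OldestFirst

/-! ### Lyapunov drift under the oldest-first policy -/

namespace Realization

variable {N M : ℕ} [NeZero N] {S : Type*} [Fintype S] [DecidableEq S] {sys : Fin N → LTI}
  {Pbar : (n : Fin N) → Matrix (Fin (sys n).l) (Fin (sys n).l) ℝ}
  {P : Matrix S S ℝ} {d : S → Fin M → ℝ} {a : Fin N → ℕ}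
  {Ω : Type*} [MeasurableSpace Ω] {μ : Measure Ω}
  (R : Realization sys Pbar P d a μ)

/-- The Foster–Lyapunov drift inequality for the oldest-first policy, on one event of the
partition. -/
lemma setLIntegral_ageWeight_succ_le (hP : ∀ i j, 0 ≤ P i j) (hd : ∀ j m, 0 ≤ d j m)
    (ha : ∀ n, 1 ≤ a n) {v : S → Fin M} {y : S → ℝ} {s θ L Y δ : ℝ} (hy : ∀ i, 0 < y i)
    (hv : ∀ i, ∑ j, P i j * d j (v i) * y j ≤ s * y i) (hθ : 0 ≤ θ) (hL : 1 ≤ L)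
    (hY : ∀ i, y i ≤ Y) (hδ : ∀ i, θ / L * Y ≤ δ * y i) (t : ℕ) (φ : Fin N → ℕ) (i : S) :
    ∫⁻ ω in R.cell (oldestFirst v) t φ i, ENNReal.ofReal
        (ageWeight θ L (R.age (oldestFirst v) (t + 1) ω) * y (R.h (t + 1) ω)) ∂μ ≤
      μ (R.cell (oldestFirst v) t φ i) *
        ENNReal.ofReal ((θ * s + δ) * (ageWeight θ L φ * y i) + θ * L ^ N * Y) := by
  have hL0 : 0 < L := zero_lt_one.trans_le hL
  have hY0 : 0 ≤ Y := (hy i).le.trans (hY i)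
  set w := ageWeight θ L φ with hw
  have hw0 : 0 ≤ w := ageWeight_nonneg hθ hL0.le φ
  set D := {ω | R.drop t ω (v i) = true} with hD
  have hDm : MeasurableSet D := R.measurableSet_drop t (v i)
  -- A drop multiplies the weight by exactly `θ`; a reception is bounded by the reset estimate, with
  -- `y` replaced by its upper bound `Y`.
  have hpt : ∀ ω ∈ R.cell (oldestFirst v) t φ i, ENNReal.ofReal
        (ageWeight θ L (R.age (oldestFirst v) (t + 1) ω) * y (R.h (t + 1) ω)) ≤
      D.indicator (fun ω => ENNReal.ofReal (θ * w * y (R.h (t + 1) ω))) ω +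
        ENNReal.ofReal ((θ * L ^ N + θ / L * w) * Y) := by
    rintro ω ⟨h1, h2⟩
    have h1' : R.age (oldestFirst v) t ω = φ := h1
    have h2' : R.h t ω = i := h2
    have hφ : ∀ n, 1 ≤ φ n := fun n => h1' ▸ R.age_pos ha (oldestFirst v) t ω n
    rw [age_succ, h1', h2', ageStep_oldestFirst]
    by_cases hdr : R.drop t ω (v i) = true
    · rw [if_pos hdr, ageWeight_add_one, Set.indicator_of_mem (show ω ∈ D from hdr)]
      exact le_self_add
    · rw [if_neg hdr, Set.indicator_of_notMem (show ω ∉ D from hdr), zero_add]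
      refine ENNReal.ofReal_le_ofReal (mul_le_mul (ageWeight_reset_le hθ hL hφ) (hY _) (hy _).le ?_)
      positivity
  refine (setLIntegral_mono' (R.measurableSet_cell _ t φ i) hpt).trans ?_
  rw [lintegral_add_right _ measurable_const, setLIntegral_const, lintegral_indicator hDm,
    Measure.restrict_restrict hDm, Set.inter_comm D]
  rw [cell, R.setLIntegral_drop (R.measurableSet_hist_age (oldestFirst v) t φ) i (v i)
    fun j => ENNReal.ofReal (θ * w * y j), mul_comm (ENNReal.ofReal _), ← mul_add]
  refine mul_le_mul_right ?_ _
  have hsum : ∑ j, ENNReal.ofReal (P i j) * ENNReal.ofReal (d j (v i)) *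
      ENNReal.ofReal (θ * w * y j) = ENNReal.ofReal (θ * w * ∑ j, P i j * d j (v i) * y j) := by
    rw [Finset.mul_sum, ENNReal.ofReal_sum_of_nonneg]
    · refine Finset.sum_congr rfl fun j _ => ?_
      rw [← ENNReal.ofReal_mul (hP _ _), ← ENNReal.ofReal_mul (mul_nonneg (hP _ _) (hd _ _))]
      congr 1
      ring
    · exact fun j _ => mul_nonneg (mul_nonneg hθ hw0)
        (mul_nonneg (mul_nonneg (hP _ _) (hd _ _)) (hy j).le)
  have hsnn : 0 ≤ ∑ j, P i j * d j (v i) * y j := Finset.sum_nonneg fun j _ =>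
    mul_nonneg (mul_nonneg (hP _ _) (hd _ _)) (hy j).le
  rw [hsum, ← ENNReal.ofReal_add (by positivity) (by positivity)]
  refine ENNReal.ofReal_le_ofReal ?_
  have h1 : θ * w * ∑ j, P i j * d j (v i) * y j ≤ θ * w * (s * y i) :=
    mul_le_mul_of_nonneg_left (hv i) (by positivity)
  have h2 : w * (θ / L * Y) ≤ w * (δ * y i) := mul_le_mul_of_nonneg_left (hδ i) hw0
  linarith

/-- Under the oldest-first policy the exponential moments of the ages stay bounded. -/
lemma exists_bound_lintegral_pow_age [IsProbabilityMeasure μ] [Nonempty S]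
    (hP : ∀ i j, 0 ≤ P i j) (hd : ∀ j m, 0 ≤ d j m)
    (ha : ∀ n, 1 ≤ a n) {v : S → Fin M} {y : S → ℝ} {s θ : ℝ} (hy : ∀ i, 0 < y i)
    (hv : ∀ i, ∑ j, P i j * d j (v i) * y j ≤ s * y i) (hs : 0 ≤ s) (hθ : 1 ≤ θ)
    (hθs : θ * s < 1) :
    ∃ B : ℝ, 0 ≤ B ∧ ∀ n t,
      ∫⁻ ω, ENNReal.ofReal (θ ^ R.age (oldestFirst v) t ω n) ∂μ ≤ ENNReal.ofReal B := by
  have hθ0 : 0 < θ := zero_lt_one.trans_le hθ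
  obtain ⟨i₀, hi₀⟩ := Finite.exists_min y
  obtain ⟨i₁, hi₁⟩ := Finite.exists_max y
  set Y := y i₁ with hYdef
  have hYpos : 0 < Y := hy i₁
  have hypos : 0 < y i₀ := hy i₀
  -- Half of the slack in `θ s < 1` goes to the reception term, and `L` is taken large enough to fit
  -- into it; the contraction factor is then `(1 + θ s)/2`.
  set δ := (1 - θ * s) / 2 with hδdef
  have hδ0 : 0 < δ := by rw [hδdef]; linarith
  set L := max 1 (θ * Y / (δ * y i₀)) with hLdef
  have hL : 1 ≤ L := le_max_left _ _
  have hL0 : 0 < L := zero_lt_one.trans_le hL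
  have hδ : ∀ i, θ / L * Y ≤ δ * y i := fun i => by
    have h1 : θ * Y / (δ * y i₀) ≤ L := le_max_right _ _
    rw [div_le_iff₀ (by positivity)] at h1
    rw [div_mul_eq_mul_div, div_le_iff₀ hL0]
    have h2 : δ * y i₀ ≤ δ * y i := mul_le_mul_of_nonneg_left (hi₀ i) hδ0.le
    nlinarith
  set γ := θ * s + δ with hγdef
  have hγ0 : 0 ≤ γ := by positivity
  have hγ1 : γ < 1 := by rw [hγdef, hδdef]; linarith
  set c := θ * L ^ N * Y with hc
  have hc0 : 0 ≤ c := by positivity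
  set V : ℕ → ℝ≥0∞ := fun t => ∫⁻ ω, ENNReal.ofReal
    (ageWeight θ L (R.age (oldestFirst v) t ω) * y (R.h t ω)) ∂μ with hV
  have hw0 : ∀ φ : Fin N → ℕ, 0 ≤ ageWeight θ L φ := ageWeight_nonneg hθ0.le hL0.le
  have hstep : ∀ t, V (t + 1) ≤ ENNReal.ofReal γ * V t + ENNReal.ofReal c := fun t => by
    calc V (t + 1) = ∑' p : (Fin N → ℕ) × S, ∫⁻ ω in R.cell (oldestFirst v) t p.1 p.2,
          ENNReal.ofReal (ageWeight θ L (R.age (oldestFirst v) (t + 1) ω) *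
            y (R.h (t + 1) ω)) ∂μ := R.lintegral_eq_tsum_cell (oldestFirst v) t _
      _ ≤ ∑' p : (Fin N → ℕ) × S, μ (R.cell (oldestFirst v) t p.1 p.2) *
            ENNReal.ofReal (γ * (ageWeight θ L p.1 * y p.2) + c) :=
          ENNReal.tsum_le_tsum fun p => R.setLIntegral_ageWeight_succ_le hP hd ha hy hv hθ0.le hL
            hi₁ hδ t p.1 p.2
      _ = ∫⁻ ω, ENNReal.ofReal (γ * (ageWeight θ L (R.age (oldestFirst v) t ω) * y (R.h t ω)) + c)
            ∂μ := (R.lintegral_age_h (oldestFirst v) t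
              fun φ i => ENNReal.ofReal (γ * (ageWeight θ L φ * y i) + c)).symm
      _ = ∫⁻ ω, ENNReal.ofReal γ * ENNReal.ofReal
            (ageWeight θ L (R.age (oldestFirst v) t ω) * y (R.h t ω)) + ENNReal.ofReal c ∂μ := by
          refine lintegral_congr fun ω => ?_
          rw [← ENNReal.ofReal_mul hγ0, ← ENNReal.ofReal_add _ hc0]
          exact mul_nonneg hγ0 (mul_nonneg (hw0 _) (hy _).le)
      _ = ENNReal.ofReal γ * V t + ENNReal.ofReal c := by
          rw [lintegral_add_right _ measurable_const, lintegral_const_mul' _ _ ENNReal.ofReal_ne_top]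
          simp [hV]
  -- A bound for the initial value plus the fixed point of `V ↦ γ V + c`.
  set b := ageWeight θ L a * Y + c / (1 - γ) with hb
  have h1γ : 0 < 1 - γ := by linarith
  have hb0 : 0 ≤ b := add_nonneg (mul_nonneg (hw0 _) hYpos.le) (by positivity)
  have hbound : ∀ t, V t ≤ ENNReal.ofReal b := by
    intro t
    induction t with
    | zero =>
      calc V 0 ≤ ∫⁻ _, ENNReal.ofReal b ∂μ := by
            refine lintegral_mono fun ω => ENNReal.ofReal_le_ofReal ?_
            have h1 : ageWeight θ L a * y (R.h 0 ω) ≤ ageWeight θ L a * Y :=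
              mul_le_mul_of_nonneg_left (hi₁ _) (hw0 _)
            have h2 : 0 ≤ c / (1 - γ) := by positivity
            change ageWeight θ L a * y (R.h 0 ω) ≤ b
            linarith
        _ = ENNReal.ofReal b := by simp
    | succ t ih =>
      refine (hstep t).trans ((add_le_add_left (mul_le_mul_right ih _) _).trans ?_)
      rw [← ENNReal.ofReal_mul hγ0, ← ENNReal.ofReal_add (by positivity) hc0]
      refine ENNReal.ofReal_le_ofReal ?_
      have h1 : γ * (ageWeight θ L a * Y) ≤ ageWeight θ L a * Y :=
        mul_le_of_le_one_left (mul_nonneg (hw0 _) hYpos.le) hγ1.le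
      have h2 : γ * (c / (1 - γ)) + c = c / (1 - γ) := by field_simp; ring
      rw [hb]
      linarith
  refine ⟨(y i₀)⁻¹ * b, by positivity, fun n t => ?_⟩
  calc ∫⁻ ω, ENNReal.ofReal (θ ^ R.age (oldestFirst v) t ω n) ∂μ
      ≤ ∫⁻ ω, ENNReal.ofReal (y i₀)⁻¹ * ENNReal.ofReal
          (ageWeight θ L (R.age (oldestFirst v) t ω) * y (R.h t ω)) ∂μ := by
        refine lintegral_mono fun ω => ?_
        rw [← ENNReal.ofReal_mul (by positivity)]
        refine ENNReal.ofReal_le_ofReal ?_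
        rw [inv_mul_eq_div, le_div_iff₀ hypos]
        exact mul_le_mul (pow_le_ageWeight hθ0.le hL _ n) (hi₀ _) hypos.le (hw0 _)
    _ = ENNReal.ofReal (y i₀)⁻¹ * V t := lintegral_const_mul' _ _ ENNReal.ofReal_ne_top
    _ ≤ ENNReal.ofReal (y i₀)⁻¹ * ENNReal.ofReal b := mul_le_mul_right (hbound t) _
    _ = _ := (ENNReal.ofReal_mul (by positivity)).symm

end Realization

/-! ### Lower bounds for the ages of information -/

/-- The long-term averages of a sequence that tends to infinity are infinite. -/
lemma limsup_average_eq_top {f : ℕ → ℝ≥0∞} (hf : Tendsto f atTop (nhds ∞)) :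
    limsup (fun T : ℕ => (∑ t ∈ Finset.range T, f t) / (T : ℝ≥0∞)) atTop = ∞ := by
  refine ENNReal.eq_top_of_forall_nnreal_le fun B => ?_
  have hB : ∀ᶠ T : ℕ in atTop,
      (B : ℝ≥0∞) ≤ (∑ t ∈ Finset.range T, f t) / (T : ℝ≥0∞) := by
    obtain ⟨t₀, ht₀⟩ := eventually_atTop.1
      (hf.eventually_const_le (show ((2 * B : NNReal) : ℝ≥0∞) < ∞ from ENNReal.coe_lt_top))
    -- At least half of the first `T` terms are at least `2B`.
    filter_upwards [eventually_ge_atTop (2 * t₀), eventually_gt_atTop 0] with T hT hT0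
    rw [ENNReal.le_div_iff_mul_le (Or.inl (by simp; omega)) (Or.inl (ENNReal.natCast_ne_top T))]
    calc (B : ℝ≥0∞) * T ≤ ∑ _t ∈ Finset.Ico t₀ T, ((2 * B : NNReal) : ℝ≥0∞) := by
          rw [Finset.sum_const, Nat.card_Ico, nsmul_eq_mul]
          have h1 : (T : NNReal) ≤ 2 * ((T - t₀ : ℕ) : NNReal) := by
            have : T ≤ 2 * (T - t₀) := by omega
            exact_mod_cast this
          have h2 : B * T ≤ ((T - t₀ : ℕ) : NNReal) * (2 * B) := by
            calc B * T ≤ B * (2 * ((T - t₀ : ℕ) : NNReal)) := mul_le_mul_right h1 B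
              _ = _ := by ring
          exact_mod_cast h2
      _ ≤ ∑ t ∈ Finset.Ico t₀ T, f t :=
          Finset.sum_le_sum fun t ht => ht₀ t (Finset.mem_Ico.1 ht).1
      _ ≤ ∑ t ∈ Finset.range T, f t :=
          Finset.sum_le_sum_of_subset fun t ht => Finset.mem_range.2 (Finset.mem_Ico.1 ht).2
  calc (B : ℝ≥0∞) ≤ liminf (fun T : ℕ => (∑ t ∈ Finset.range T, f t) / (T : ℝ≥0∞)) atTop :=
        le_liminf_of_le (by isBoundedDefault) hB
    _ ≤ _ := liminf_le_limsup

lemma limsup_average_le {f : ℕ → ℝ≥0∞} {B : ℝ≥0∞} (hf : ∀ t, f t ≤ B) :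
    limsup (fun T : ℕ => (∑ t ∈ Finset.range T, f t) / (T : ℝ≥0∞)) atTop ≤ B := by
  refine limsup_le_of_le (by isBoundedDefault) (Eventually.of_forall fun T => ?_)
  refine ENNReal.div_le_of_le_mul ?_
  calc ∑ t ∈ Finset.range T, f t ≤ ∑ _t ∈ Finset.range T, B := Finset.sum_le_sum fun t _ => hf t
    _ = B * T := by rw [Finset.sum_const, Finset.card_range, nsmul_eq_mul, mul_comm]

/-- For an irreducible matrix, the first powers applied to a nonzero nonnegative vector have
a positive sum. -/
lemma exists_pos_le_sum_pow_mulVec {S : Type*} [Fintype S] [DecidableEq S] [Nonempty S]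
    {P : Matrix S S ℝ} (hP : P.IsIrreducible) {x : S → ℝ} (hx : 0 ≤ x) (hx0 : x ≠ 0) :
    ∃ (K : ℕ) (δ : ℝ), 0 < δ ∧ ∀ i, δ ≤ ∑ k ∈ Finset.range K, (P ^ (k + 1) *ᵥ x) i := by
  have hnn : ∀ i j, 0 ≤ P i j := hP.nonneg
  obtain ⟨j, hj⟩ : ∃ j, x j ≠ 0 := Function.ne_iff.1 hx0
  have hj0 : 0 < x j := lt_of_le_of_ne (hx j) (Ne.symm hj)
  choose k hk0 hk using fun i => (Matrix.isIrreducible_iff_exists_pow_pos hnn).1 hP i j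
  have hpnn : ∀ n i, 0 ≤ (P ^ n *ᵥ x) i := fun n i =>
    Finset.sum_nonneg fun l _ => mul_nonneg (pow_apply_nonneg hnn n i l) (hx l)
  obtain ⟨i₀, hi₀⟩ := Finite.exists_min fun i => (P ^ k i *ᵥ x) i
  -- The sum of the `k i` merely bounds each of them, so that one range contains all the powers
  -- needed.
  refine ⟨∑ i, k i, (P ^ k i₀ *ᵥ x) i₀, ?_, fun i => (hi₀ i).trans ?_⟩
  · refine (mul_pos (hk i₀) hj0).trans_le ?_
    exact Finset.single_le_sum (f := fun l => (P ^ k i₀) i₀ l * x l)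
      (fun l _ => mul_nonneg (pow_apply_nonneg hnn _ _ _) (hx l)) (Finset.mem_univ j)
  · have h1 : k i - 1 ∈ Finset.range (∑ i, k i) := by
      have h2 : k i ≤ ∑ i, k i := Finset.single_le_sum (fun _ _ => Nat.zero_le _) (Finset.mem_univ i)
      have := hk0 i
      rw [Finset.mem_range]; omega
    have h3 := Finset.single_le_sum (f := fun l => (P ^ (l + 1) *ᵥ x) i)
      (fun l _ => hpnn (l + 1) i) h1
    simp only [Nat.sub_add_cancel (hk0 i)] at h3
    exact h3

namespace Realization

variable {N M : ℕ} {S : Type*} [Fintype S] [DecidableEq S] {sys : Fin N → LTI}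
  {Pbar : (n : Fin N) → Matrix (Fin (sys n).l) (Fin (sys n).l) ℝ}
  {P : Matrix S S ℝ} {d : S → Fin M → ℝ} {a : Fin N → ℕ}
  {Ω : Type*} [MeasurableSpace Ω] {μ : Measure Ω}
  (R : Realization sys Pbar P d a μ)

lemma cost_eq_top_of_tendsto {π : Policy N M S} {n : Fin N}
    (h : Tendsto (fun t => R.mse π n t) atTop (nhds ∞)) : R.cost π = ∞ := by
  refine top_le_iff.1 ?_
  rw [← limsup_average_eq_top h]
  exact Finset.single_le_sum (f := fun n => limsup
    (fun T : ℕ => (∑ t ∈ Finset.range T, R.mse π n t) / (T : ℝ≥0∞)) atTop)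
    (fun _ _ => zero_le) (Finset.mem_univ n)

lemma cost_lt_top_of_forall_le {π : Policy N M S}
    (h : ∀ n, ∃ B : ℝ, ∀ t, R.mse π n t ≤ ENNReal.ofReal B) : R.cost π < ∞ := by
  refine ENNReal.sum_lt_top.2 fun n _ => ?_
  obtain ⟨B, hB⟩ := h n
  exact (limsup_average_le hB).trans_lt ENNReal.ofReal_lt_top

/-- Under any policy, the geometric sums of the age of a process, weighted with a sub-eigenvector of
the failure matrices, grow on average at least by the weight of the current state. -/
lemma lintegral_geom_sum_age_succ_ge [NeZero M] (hP : ∀ i j, 0 ≤ P i j) (hd : ∀ j m, 0 ≤ d j m)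
    (π : Policy N M S) (n : Fin N) {x : S → ℝ} (hx : 0 ≤ x) {q r : ℝ} (hq : 0 ≤ q)
    (hqr : 1 ≤ q * r) (hr : ∀ i m, r * x i ≤ ∑ j, P i j * d j m * x j) (t : ℕ) :
    ∫⁻ ω, ENNReal.ofReal ((∑ k ∈ Finset.range (R.age π t ω n), q ^ k) * x (R.h t ω)) ∂μ +
        ∫⁻ ω, ENNReal.ofReal (x (R.h (t + 1) ω)) ∂μ ≤
      ∫⁻ ω, ENNReal.ofReal ((∑ k ∈ Finset.range (R.age π (t + 1) ω n), q ^ k) *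
        x (R.h (t + 1) ω)) ∂μ := by
  have hg0 : ∀ k : ℕ, 0 ≤ ∑ i ∈ Finset.range k, q ^ i := fun k => by positivity
  rw [R.lintegral_age_h π t
      fun φ i => ENNReal.ofReal ((∑ k ∈ Finset.range (φ n), q ^ k) * x i),
    R.lintegral_eq_tsum_cell π t fun ω => ENNReal.ofReal (x (R.h (t + 1) ω)),
    R.lintegral_eq_tsum_cell π t, ← ENNReal.tsum_add]
  refine ENNReal.tsum_le_tsum ?_
  rintro ⟨φ, i⟩
  set g : ℝ := ∑ k ∈ Finset.range (φ n), q ^ k with hg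
  have hg' : 0 ≤ g := hg0 _
  -- An unscheduled process is treated as if it used channel `0`. Its age grows in any case, so
  -- counting the growth only when that channel drops can only weaken the bound.
  set m : Fin M := (π.select φ i n).getD 0 with hm
  set D := {ω | R.drop t ω m = true} with hD
  have hDm : MeasurableSet D := R.measurableSet_drop t m
  -- One more slot of age turns the geometric sum `g` into `q g + 1`; after a reception the sum is
  -- still at least `1`. The unit term yields the increment `x`.
  have hpt : ∀ ω ∈ R.cell π t φ i,
      D.indicator (fun ω => ENNReal.ofReal (q * g * x (R.h (t + 1) ω))) ω +
        ENNReal.ofReal (x (R.h (t + 1) ω)) ≤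
      ENNReal.ofReal ((∑ k ∈ Finset.range (R.age π (t + 1) ω n), q ^ k) *
        x (R.h (t + 1) ω)) := by
    rintro ω ⟨h1, h2⟩
    have h1' : R.age π t ω = φ := h1
    have h2' : R.h t ω = i := h2
    have hxn : 0 ≤ x (R.h (t + 1) ω) := hx _
    rw [age_succ, h1', h2']
    by_cases hdr : ω ∈ D
    · have hage : π.ageStep φ i (R.drop t ω) n = φ n + 1 := by
        refine if_neg ?_
        rintro ⟨m', hm', hdm'⟩
        have : m = m' := by rw [hm, hm', Option.getD_some]
        rw [← this] at hdm'
        have hdr' : R.drop t ω m = true := hdr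
        rw [hdm'] at hdr'
        exact Bool.false_ne_true hdr'
      rw [Set.indicator_of_mem hdr, hage, ← ENNReal.ofReal_add (by positivity) hxn,
        geom_sum_succ, add_mul, one_mul]
    · rw [Set.indicator_of_notMem hdr, zero_add]
      refine ENNReal.ofReal_le_ofReal (le_mul_of_one_le_left hxn ?_)
      have hpos : π.ageStep φ i (R.drop t ω) n = (π.ageStep φ i (R.drop t ω) n - 1) + 1 := by
        rw [Policy.ageStep]; split_ifs <;> omega
      rw [hpos, geom_sum_succ]
      exact le_add_of_nonneg_left (mul_nonneg hq (hg0 _))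
  refine le_trans ?_ (setLIntegral_mono' (R.measurableSet_cell π t φ i) hpt)
  have hmeas : Measurable (D.indicator fun ω => ENNReal.ofReal (q * g * x (R.h (t + 1) ω))) := by
    refine Measurable.indicator ?_ hDm
    have h1 : Measurable[⊤] (fun j : S => ENNReal.ofReal (q * g * x j)) := measurable_from_top
    exact h1.comp (measurable_iff_comap_le.2 (R.comap_h_le (t + 1)))
  rw [lintegral_add_left hmeas]
  refine add_le_add_left ?_ _
  rw [lintegral_indicator hDm, Measure.restrict_restrict hDm, Set.inter_comm D, cell,
    R.setLIntegral_drop (R.measurableSet_hist_age π t φ) i m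
      fun j => ENNReal.ofReal (q * g * x j)]
  refine mul_le_mul_right ?_ _
  have hsum : ∑ j, ENNReal.ofReal (P i j) * ENNReal.ofReal (d j m) *
      ENNReal.ofReal (q * g * x j) = ENNReal.ofReal (q * g * ∑ j, P i j * d j m * x j) := by
    rw [Finset.mul_sum Finset.univ, ENNReal.ofReal_sum_of_nonneg]
    · refine Finset.sum_congr rfl fun j _ => ?_
      rw [← ENNReal.ofReal_mul (hP _ _), ← ENNReal.ofReal_mul (mul_nonneg (hP _ _) (hd _ _))]
      congr 1
      ring
    · exact fun j _ => mul_nonneg (mul_nonneg hq hg')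
        (mul_nonneg (mul_nonneg (hP _ _) (hd _ _)) (hx j))
  rw [hsum]
  refine ENNReal.ofReal_le_ofReal ?_
  have h1 : q * g * (r * x i) ≤ q * g * ∑ j, P i j * d j m * x j :=
    mul_le_mul_of_nonneg_left (hr i m) (by positivity)
  have h2 : g * x i ≤ q * r * (g * x i) := le_mul_of_one_le_left (mul_nonneg hg' (hx i)) hqr
  linarith

/-- If `q * r ≥ 1`, the weighted geometric sums of the ages tend to infinity in mean. -/
lemma tendsto_lintegral_geom_sum_age [NeZero M] [IsProbabilityMeasure μ] [Nonempty S]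
    (hP : ∀ i j, 0 ≤ P i j) (hd : ∀ j m, 0 ≤ d j m) (hirr : P.IsIrreducible)
    (π : Policy N M S) (n : Fin N) {x : S → ℝ} (hx : 0 ≤ x) (hx0 : x ≠ 0) {q r : ℝ} (hq : 0 ≤ q)
    (hqr : 1 ≤ q * r) (hr : ∀ i m, r * x i ≤ ∑ j, P i j * d j m * x j) :
    Tendsto (fun t => ∫⁻ ω, ENNReal.ofReal
      ((∑ k ∈ Finset.range (R.age π t ω n), q ^ k) * x (R.h t ω)) ∂μ) atTop (nhds ∞) := by
  set Z : ℕ → ℝ≥0∞ := fun t => ∫⁻ ω, ENNReal.ofReal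
      ((∑ k ∈ Finset.range (R.age π t ω n), q ^ k) * x (R.h t ω)) ∂μ with hZ
  set u : ℕ → ℝ≥0∞ := fun t => ∫⁻ ω, ENNReal.ofReal (x (R.h t ω)) ∂μ with hu
  have hstep : ∀ t, Z t + u (t + 1) ≤ Z (t + 1) := fun t =>
    R.lintegral_geom_sum_age_succ_ge hP hd π n hx hq hqr hr t
  have hmono : Monotone Z := monotone_nat_of_le_succ fun t => le_self_add.trans (hstep t)
  obtain ⟨K, δ, hδ, hK⟩ := exists_pos_le_sum_pow_mulVec hirr hx hx0
  have hsum : ∀ t j, Z t + ∑ k ∈ Finset.range j, u (t + (k + 1)) ≤ Z (t + j) := by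
    intro t j
    induction j with
    | zero => simp
    | succ j ih =>
      rw [Finset.sum_range_succ, ← add_assoc]
      exact (add_le_add_left ih _).trans (hstep (t + j))
  -- Irreducibility makes the increments over `K` consecutive slots total at least `δ`, whatever the
  -- state at time `t`; so `Z` grows at least linearly.
  have hblock : ∀ t, Z t + ENNReal.ofReal δ ≤ Z (t + K) := fun t => by
    refine (add_le_add_right ?_ _).trans (hsum t K)
    have hpnn : ∀ l i, 0 ≤ (P ^ l *ᵥ x) i := fun l i =>
      Finset.sum_nonneg fun j _ => mul_nonneg (pow_apply_nonneg hP l i j) (hx j)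
    have hmeas : ∀ l, Measurable fun ω => ENNReal.ofReal ((P ^ l *ᵥ x) (R.h t ω)) := fun l => by
      have h1 : Measurable[⊤] (fun j : S => ENNReal.ofReal ((P ^ l *ᵥ x) j)) := measurable_from_top
      exact h1.comp (measurable_iff_comap_le.2 (R.comap_h_le t))
    calc ENNReal.ofReal δ = ∫⁻ _, ENNReal.ofReal δ ∂μ := by simp
      _ ≤ ∫⁻ ω, ∑ k ∈ Finset.range K, ENNReal.ofReal ((P ^ (k + 1) *ᵥ x) (R.h t ω)) ∂μ := by
          refine lintegral_mono fun ω => ?_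
          rw [← ENNReal.ofReal_sum_of_nonneg fun k _ => hpnn (k + 1) _]
          exact ENNReal.ofReal_le_ofReal (hK _)
      _ = ∑ k ∈ Finset.range K, u (t + (k + 1)) := by
          rw [lintegral_finsetSum _ fun k _ => hmeas (k + 1)]
          exact Finset.sum_congr rfl fun k _ => (R.lintegral_h_add hP t (k + 1) hx).symm
  have hlin : ∀ j : ℕ, ENNReal.ofReal (j * δ) ≤ Z (j * K) := by
    intro j
    induction j with
    | zero => simp
    | succ j ih =>
      rw [Nat.cast_add_one, add_mul, one_mul, ENNReal.ofReal_add (by positivity) hδ.le,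
        Nat.succ_mul]
      exact (add_le_add_left ih _).trans (hblock _)
  rw [ENNReal.tendsto_nhds_top_iff_nnreal]
  intro B
  obtain ⟨j, hj⟩ := exists_nat_gt ((B : ℝ) / δ)
  rw [div_lt_iff₀ hδ] at hj
  filter_upwards [eventually_ge_atTop (j * K)] with t ht
  refine lt_of_lt_of_le ?_ ((hlin j).trans (hmono ht))
  rw [← ENNReal.ofReal_coe_nnreal]
  exact (ENNReal.ofReal_lt_ofReal_iff_of_nonneg B.coe_nonneg).2 hj

/-- Processes without exponential growth are stable under every policy. -/
lemma cost_lt_top_of_specRad_lt_one [IsProbabilityMeasure μ]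
    (hPbar : ∀ n, (sys n).IsSteadyState (Pbar n)) (ha : ∀ n, 1 ≤ a n)
    (hA : ∀ n, specRad (sys n).A < 1) (π : Policy N M S) : R.cost π < ∞ := by
  refine R.cost_lt_top_of_forall_le fun n => ?_
  obtain ⟨c, -, hc⟩ := LTI.exists_trace_le_const (Pbar n) (hA n)
  refine ⟨c, fun t => ?_⟩
  rw [R.mse_eq hPbar ha]
  calc _ ≤ ∫⁻ _, ENNReal.ofReal c ∂μ :=
        lintegral_mono fun ω => ENNReal.ofReal_le_ofReal (hc _)
    _ = ENNReal.ofReal c := by simp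

/-- The oldest-first policy has a finite cost if the failure matrix of the chosen channels has
a positive super-eigenvector with a small enough eigenvalue. -/
lemma cost_oldestFirst_lt_top [NeZero N] [IsProbabilityMeasure μ] [Nonempty S]
    (hPbar : ∀ n, (sys n).IsSteadyState (Pbar n)) (ha : ∀ n, 1 ≤ a n)
    (hP : ∀ i j, 0 ≤ P i j) (hd : ∀ j m, 0 ≤ d j m) {v : S → Fin M} {y : S → ℝ} {s θ : ℝ}
    (hy : ∀ i, 0 < y i) (hv : ∀ i, ∑ j, P i j * d j (v i) * y j ≤ s * y i) (hs : 0 ≤ s)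
    (hθ : 1 < θ) (hθs : θ * s < 1) (hA : ∀ n, specRad (sys n).A ^ 2 < θ) :
    R.cost (oldestFirst v) < ∞ := by
  refine R.cost_lt_top_of_forall_le fun n => ?_
  obtain ⟨c, hc0, hc⟩ := LTI.exists_trace_le_pow (Pbar n) hθ (hA n)
  obtain ⟨B, -, hB⟩ := R.exists_bound_lintegral_pow_age hP hd ha hy hv hs hθ.le hθs
  refine ⟨c * B, fun t => ?_⟩
  rw [R.mse_eq hPbar ha]
  calc _ ≤ ∫⁻ ω, ENNReal.ofReal c * ENNReal.ofReal (θ ^ R.age (oldestFirst v) t ω n) ∂μ := by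
        refine lintegral_mono fun ω => ?_
        rw [← ENNReal.ofReal_mul hc0.le]
        exact ENNReal.ofReal_le_ofReal (hc _)
    _ ≤ ENNReal.ofReal c * ENNReal.ofReal B := by
        rw [lintegral_const_mul' _ _ ENNReal.ofReal_ne_top]
        exact mul_le_mul_right (hB n t) _
    _ = ENNReal.ofReal (c * B) := (ENNReal.ofReal_mul hc0.le).symm

/-- No policy has a finite cost if the growth of one process outweighs the best failure rate. -/
lemma cost_eq_top [NeZero M] [IsProbabilityMeasure μ] [Nonempty S]
    (hPbar : ∀ n, (sys n).IsSteadyState (Pbar n)) (ha : ∀ n, 1 ≤ a n)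
    (hP : ∀ i j, 0 ≤ P i j) (hd : ∀ j m, 0 ≤ d j m) (hirr : P.IsIrreducible) (n : Fin N)
    (hA : 1 ≤ specRad (sys n).A) {x : S → ℝ} (hx : 0 ≤ x) (hx0 : x ≠ 0) {r : ℝ}
    (hr : ∀ i m, r * x i ≤ ∑ j, P i j * d j m * x j)
    (hAr : 1 ≤ specRad (sys n).A ^ 2 * r) (π : Policy N M S) : R.cost π = ∞ := by
  obtain ⟨ε, hε, hlow⟩ := (hPbar n).exists_mul_geom_sum_le_trace hA
  obtain ⟨i₁, hi₁⟩ := Finite.exists_max x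
  have hX : 0 < x i₁ := by
    obtain ⟨j, hj⟩ : ∃ j, x j ≠ 0 := Function.ne_iff.1 hx0
    exact (lt_of_le_of_ne (hx j) (Ne.symm hj)).trans_le (hi₁ j)
  have hZ := R.tendsto_lintegral_geom_sum_age hP hd hirr π n hx hx0
    (sq_nonneg (specRad (sys n).A)) hAr hr
  have hε' : 0 < ε / x i₁ := by positivity
  refine R.cost_eq_top_of_tendsto (n := n) ?_
  -- Dividing by the largest coordinate of `x` removes the weight `x(h)` from the lower bound.
  have hmul := ENNReal.Tendsto.const_mul (a := ENNReal.ofReal (ε / x i₁)) hZ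
    (Or.inl ENNReal.top_ne_zero)
  rw [ENNReal.mul_top (ENNReal.ofReal_pos.2 hε').ne'] at hmul
  refine tendsto_nhds_top_mono' hmul fun t => ?_
  rw [R.mse_eq hPbar ha]
  simp only
  rw [← lintegral_const_mul' _ _ ENNReal.ofReal_ne_top]
  refine lintegral_mono fun ω => ?_
  rw [← ENNReal.ofReal_mul hε'.le]
  refine ENNReal.ofReal_le_ofReal (le_trans ?_ (hlow _))
  rw [div_mul_eq_mul_div, div_le_iff₀ hX, ← mul_assoc]
  exact mul_le_mul_of_nonneg_left (hi₁ _) (by positivity)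

end Realization

end RemoteEst

end

/-! ### The stability criterion -/

theorem theorem3 {N M : ℕ} [NeZero N] [NeZero M]
    {S : Type*} [Fintype S] [DecidableEq S]
    (sys : Fin N → RemoteEst.LTI)
    (Pbar : (n : Fin N) → Matrix (Fin (sys n).l) (Fin (sys n).l) ℝ)
    (hPbar : ∀ n, (sys n).IsSteadyState (Pbar n))
    (hord : Antitone fun n => RemoteEst.specRad (sys n).A)
    (P : Matrix S S ℝ) (d : S → Fin M → ℝ)
    (hchan : RemoteEst.IsHiddenMarkovChannel P d)
    (a : Fin N → ℕ) (ha : ∀ n, 1 ≤ a n)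
    {Ω : Type*} [MeasurableSpace Ω] (μ : Measure Ω) [IsProbabilityMeasure μ]
    (R : RemoteEst.Realization sys Pbar P d a μ) :
    R.IsStable ↔ RemoteEst.specRad (sys 0).A ^ 2 * RemoteEst.lamInf P d < 1 := by
  have hP : ∀ i j, 0 ≤ P i j := hchan.irreducible.nonneg
  have hd : ∀ j m, 0 ≤ d j m := fun j m => (hchan.drop_mem j m).1
  obtain ⟨ω₀⟩ : Nonempty Ω := nonempty_of_isProbabilityMeasure μ
  have : Nonempty S := ⟨R.h 0 ω₀⟩
  have hord0 : ∀ n, RemoteEst.specRad (sys n).A ≤ RemoteEst.specRad (sys 0).A := fun n =>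
    hord (Fin.zero_le n)
  obtain ⟨hr0, ⟨x, hx, hx0, hxr⟩, hy⟩ := RemoteEst.lamInf_spec hP hd
  rcases lt_or_ge (RemoteEst.specRad (sys 0).A) 1 with hlt | hge
  -- Compare at the largest coordinate of the sub-eigenvector: the rows of `P` sum to one and drop
  -- probabilities are at most one.
  · have hone : RemoteEst.lamInf P d ≤ 1 := by
      obtain ⟨i₁, hi₁⟩ := Finite.exists_max x
      have hX : 0 < x i₁ := by
        obtain ⟨j, hj⟩ : ∃ j, x j ≠ 0 := Function.ne_iff.1 hx0
        exact (lt_of_le_of_ne (hx j) (Ne.symm hj)).trans_le (hi₁ j)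
      have hrow : ∑ j, P i₁ j = 1 := by
        have := congrFun hchan.stochastic.2 i₁
        simpa [Matrix.mulVec, dotProduct] using this
      have h1 : ∑ j, P i₁ j * d j 0 * x j ≤ ∑ j, P i₁ j * x i₁ :=
        Finset.sum_le_sum fun j _ => mul_le_mul
          (mul_le_of_le_one_right (hP _ _) (hchan.drop_mem j 0).2) (hi₁ j) (hx j) (hP _ _)
      rw [← Finset.sum_mul, hrow] at h1
      exact le_of_mul_le_mul_right ((hxr i₁ 0).trans h1) hX
    have h0 := RemoteEst.specRad_nonneg (sys 0).A
    refine iff_of_true ⟨RemoteEst.oldestFirst fun _ => 0, R.cost_lt_top_of_specRad_lt_one hPbar ha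
      (fun n => (hord0 n).trans_lt hlt) _⟩ ?_
    nlinarith
  · constructor
    · rintro ⟨π, hπ⟩
      by_contra hcon
      exact hπ.ne (R.cost_eq_top hPbar ha hP hd hchan.irreducible 0 hge hx hx0 hxr
        (not_lt.1 hcon) π)
    · intro h
      have hρ : 0 < RemoteEst.specRad (sys 0).A ^ 2 := by positivity
      -- The strict inequality leaves room for `λ'_∞ < s < 1/ρ²` and then `ρ² < θ < 1/s`; `θ > 1`
      -- follows from `ρ ≥ 1`.
      obtain ⟨s, hs, hs1⟩ := exists_between ((lt_div_iff₀' hρ).2 h)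
      have hs0 : 0 < s := hr0.trans_lt hs
      obtain ⟨θ, hθ, hθ1⟩ := exists_between ((lt_div_iff₀ hs0).2 ((lt_div_iff₀' hρ).1 hs1))
      obtain ⟨y, v, hy0, hyv⟩ := hy s hs
      have hθ' : 1 < θ := lt_of_le_of_lt (one_le_pow₀ hge) hθ
      refine ⟨RemoteEst.oldestFirst v, R.cost_oldestFirst_lt_top hPbar ha hP hd hy0 hyv hs0.le hθ'
        ((lt_div_iff₀ hs0).1 hθ1) fun n => lt_of_le_of_lt ?_ hθ⟩
      exact pow_le_pow_left₀ (RemoteEst.specRad_nonneg _) (hord0 n) 2
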